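/- **Theorem (adaptive sparse recovery, low sparsity regime).** For $x\in\mathbb R^n$ and an integer $s\ge 0$, let $H_s(x)$ be a set of $\min(s,n)$ coordinates of $x$ of largest magnitude (ties broken arbitrarily), and let $x_{-s}$ be $x$ with the coordinates in $H_s(x)$ set to zero. A *randomized adaptive algorithm* is a probability distribution over deterministic adaptive algorithms. A deterministic adaptive algorithm proceeds in rounds: in each round it chooses a finite batch of linear functionals on $\mathbb R^n$, depending only on the values observed in earlier rounds, and observes their exact values on $x$; finally it outputs a vector $\hat x\in\mathbb R^n$ that depends only on the observed values. Each functional counts as one measurement. For all constants $a,b,d>0$ there is a constant $C>0$, depending only on $a,b,d$, such that the following holds. Let $n\ge 3$ and $k\ge 1$ be integers and $0<\epsilon\le 1$, with $$\frac{k}{\epsilon}\le b\,(\log n)^{a}.$$ Then there is a randomized adaptive algorithm which on every $x\in\mathbb R^n$, and for every outcome of its random choices, performs at most $C\,\frac{k}{\epsilon}\log\log n$ linear measurements in at most $C\log\log n$ rounds, and such that for every $x\in\mathbb R^n$, with probability at least $1-\frac{1}{(\log n)^{d}}$, its output $\hat x$ satisfies both the $\ell_2/\ell_2$ guarantee $$\|x-\hat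 x\|_2^2\le(1+\epsilon)\,\|x_{-k}\|_2^2$$ and the $\ell_\infty/\ell_2$ guarantee $$|x_i-\hat x_i|^2\le\frac{\epsilon}{k}\,\bigl\|x_{-\lceil k/\epsilon\rceil}\bigr\|_2^2\qquad\text{for all } i\in\{1,\dots,n\}.$$ -/

import Mathlib

/-- A deterministic adaptive linear-measurement algorithm for signals in `ℝⁿ`, as a decision tree.
Either it stops and outputs a vector, or it performs one round: it chooses a batch of `q` linear
measurements (the rows of a matrix `A`), all fixed before any of their values is seen, observes
the exact values `A x`, and continues in a way that may depend on them. -/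
inductive AdaptiveAlgorithm (n : ℕ) : Type
  | output (v : EuclideanSpace ℝ (Fin n)) : AdaptiveAlgorithm n
  | measure (q : ℕ) (A : Matrix (Fin q) (Fin n) ℝ)
      (next : (Fin q → ℝ) → AdaptiveAlgorithm n) : AdaptiveAlgorithm n

namespace AdaptiveAlgorithm

/-- The output `x̂` of the algorithm on the signal `x`. -/
noncomputable def run {n : ℕ} :
    AdaptiveAlgorithm n → EuclideanSpace ℝ (Fin n) → EuclideanSpace ℝ (Fin n)
  | output v, _ => v
  | measure _ A next, x => (next (A.mulVec x.ofLp)).run x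

/-- The total number of linear measurements performed on the signal `x`. -/
noncomputable def numMeasurements {n : ℕ} :
    AdaptiveAlgorithm n → EuclideanSpace ℝ (Fin n) → ℕ
  | output _, _ => 0
  | measure q A next, x => q + (next (A.mulVec x.ofLp)).numMeasurements x

/-- The number of rounds of adaptivity used on the signal `x`. -/
noncomputable def numRounds {n : ℕ} :
    AdaptiveAlgorithm n → EuclideanSpace ℝ (Fin n) → ℕ
  | output _, _ => 0
  | measure _ A next, x => 1 + (next (A.mulVec x.ofLp)).numRounds x

end AdaptiveAlgorithm

/-- A randomized adaptive algorithm: a probability distribution over deterministic ones (all random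
choices are drawn in advance, independently of the signal). -/
abbrev RandomizedAdaptiveAlgorithm (n : ℕ) : Type := PMF (AdaptiveAlgorithm n)

/-- The probability, over the internal randomness, of an event about the drawn algorithm. -/
noncomputable def RandomizedAdaptiveAlgorithm.prob {n : ℕ} (𝒜 : RandomizedAdaptiveAlgorithm n)
    (P : AdaptiveAlgorithm n → Prop) : ENNReal :=
  PMF.toOuterMeasure 𝒜 {A | P A}

/-- `H_k(x)`: the `k` largest coordinates of `x` in magnitude (all of them if `k ≥ n`), ties being
broken by a fixed sorting. -/
noncomputable def headSet {n : ℕ} (k : ℕ) (x : EuclideanSpace ℝ (Fin n)) : Finset (Fin n) :=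
  Finset.univ.filter fun i => ((Tuple.sort fun j => -|x j|).symm i : ℕ) < k

/-- `x_{-k}`: the vector `x` with the coordinates in `H_k(x)` set to zero. -/
noncomputable def tailVec {n : ℕ} (k : ℕ) (x : EuclideanSpace ℝ (Fin n)) :
    EuclideanSpace ℝ (Fin n) :=
  WithLp.toLp 2 fun i => if i ∈ headSet k x then 0 else x i

theorem card_headSet {n : ℕ} (k : ℕ) (x : EuclideanSpace ℝ (Fin n)) :
    (headSet k x).card = min k n := by
  classical
  have h : headSet k x = (Finset.univ.filter fun i : Fin n => (i : ℕ) < k).map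
      (Tuple.sort fun j => -|x j|).toEmbedding := by
    ext i
    simp only [headSet, Finset.mem_filter, Finset.mem_univ, true_and, Finset.mem_map_equiv]
  rw [h, Finset.card_map, Fin.card_filter_val_lt, min_comm]

theorem abs_le_abs_of_mem_headSet {n : ℕ} {k : ℕ} {x : EuclideanSpace ℝ (Fin n)} {i j : Fin n}
    (hi : i ∈ headSet k x) (hj : j ∉ headSet k x) : |x j| ≤ |x i| := by
  simp only [headSet, Finset.mem_filter, Finset.mem_univ, true_and, not_lt] at hi hj
  have h := Tuple.monotone_sort (fun l => -|x l|)
    (show (Tuple.sort fun l => -|x l|).symm i ≤ (Tuple.sort fun l => -|x l|).symm j from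
      Fin.le_def.mpr (by omega))
  simpa using h

/-! Put K = ⌈k/ε⌉ and call a coordinate heavy if its square exceeds ‖x_{-K}‖²/K; there are at most
2K of these. The last round reads candidate coordinates exactly, so every output entry is either x_i
or 0, and spurious candidates do no harm. Hence it suffices to have all heavy coordinates among O(K)
candidates (`guarantees_of_heavy`).

To find them, every coordinate gets a random label, a number with `level T` base-m digits, where m
is a power of log n. Its first six digits name its bucket. There are only polylogarithmically many
buckets, so R = O(log log n) repetitions of a signed hashing into O(K) cells, decided by majority,
survive a union bound over all of them (`pr_badRep_le`, `pr_majority_le`). This leaves O(K) slots.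
Since K is polylogarithmic too, a large enough power m isolates the heavy coordinates in their
buckets.

Each later round measures, for every slot, the signed sum over its class of labels and the same sum
weighted by a longer prefix of the label. The ratio, rounded, is the longer prefix of the heavy
coordinate (`decode_slot_eq`). Fixing c digits cuts the noise energy by m^c, while passing to c'
digits inflates it by at most m^(2(c'-c)); so c' can be almost 3c/2. Prefix lengths thus grow
geometrically, and O(log log n) rounds determine a label long enough to be unique.

All failure events concern the true classes of heavy coordinates, not the adaptive transcript. The
same labels and signs therefore serve every refinement round, and a union bound suffices
(`pr_badLabels_le`, `pr_recover_fails_le`). -/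

namespace SparseRecovery

open Finset
open scoped BigOperators

/-! ### Uniform probability on finite sample spaces -/

section Probability

variable {Ω Ω' : Type*} [Fintype Ω] [Fintype Ω']

open Classical in
/-- The probability of an event under the uniform distribution on a finite type. -/
noncomputable def pr (p : Ω → Prop) : ℝ := 𝔼 ω, if p ω then (1 : ℝ) else 0

theorem pr_eq_card_div (p : Ω → Prop) [DecidablePred p] :
    pr p = #{ω | p ω} / Fintype.card Ω := by
  rw [pr, Fintype.expect_eq_sum_div_card, ← Finset.sum_boole]
  congr! 3

theorem pr_mono {p q : Ω → Prop} (h : ∀ ω, p ω → q ω) : pr p ≤ pr q := by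
  classical
  refine expect_le_expect fun ω _ => ?_
  by_cases hp : p ω
  · simp [hp, h ω hp]
  · simp only [hp, if_false]; split_ifs <;> norm_num

theorem pr_or_le (p q : Ω → Prop) : pr (fun ω => p ω ∨ q ω) ≤ pr p + pr q := by
  classical
  unfold pr
  rw [← expect_add_distrib]
  refine expect_le_expect fun ω _ => ?_
  by_cases hp : p ω <;> by_cases hq : q ω <;> simp [hp, hq]

theorem pr_exists_le {ι : Type*} (s : Finset ι) (p : ι → Ω → Prop) :
    pr (fun ω => ∃ i ∈ s, p i ω) ≤ ∑ i ∈ s, pr (p i) := by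
  classical
  induction s using Finset.induction_on with
  | empty => simp [pr]
  | insert a s ha ih =>
    rw [sum_insert ha]
    calc pr (fun ω => ∃ i ∈ insert a s, p i ω) ≤ pr (fun ω => p a ω ∨ ∃ i ∈ s, p i ω) :=
          pr_mono fun ω h => by simpa using h
      _ ≤ _ := (pr_or_le _ _).trans (by gcongr)

theorem pr_exists_le_card_mul {ι : Type*} (s : Finset ι) (p : ι → Ω → Prop) {c : ℝ}
    (h : ∀ i ∈ s, pr (p i) ≤ c) : pr (fun ω => ∃ i ∈ s, p i ω) ≤ #s * c := by
  refine (pr_exists_le s p).trans ((sum_le_sum h).trans ?_)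
  simp

theorem pr_le_expect_div {f : Ω → ℝ} (hf : ∀ ω, 0 ≤ f ω) {c : ℝ} (hc : 0 < c) :
    pr (fun ω => c ≤ f ω) ≤ (𝔼 ω, f ω) / c := by
  classical
  rw [le_div_iff₀ hc, pr, expect_mul]
  refine expect_le_expect fun ω _ => ?_
  split_ifs with h
  · simpa using h
  · simpa using hf ω

theorem expect_prod (f : Ω × Ω' → ℝ) : 𝔼 ω, f ω = 𝔼 a, 𝔼 b, f (a, b) := by
  rw [← univ_product_univ, expect_product]

theorem expect_le_const [Nonempty Ω] {f : Ω → ℝ} {c : ℝ} (h : ∀ ω, f ω ≤ c) : 𝔼 ω, f ω ≤ c :=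
  (expect_le_expect fun ω _ => h ω).trans (by simp)

theorem pr_prod_le_of_fst [Nonempty Ω] {p : Ω × Ω' → Prop} {c : ℝ}
    (h : ∀ a, pr (fun b => p (a, b)) ≤ c) : pr p ≤ c := by
  rw [pr, expect_prod]
  exact expect_le_const h

theorem pr_prod_le_of_snd [Nonempty Ω'] {p : Ω × Ω' → Prop} {c : ℝ}
    (h : ∀ b, pr (fun a => p (a, b)) ≤ c) : pr p ≤ c := by
  rw [pr, expect_prod, expect_comm]
  exact expect_le_const h

/-- If each repetition is bad with probability at most `1/16`, then at least half of `R`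
independent repetitions are bad with probability at most `2⁻ᴿ`. -/
theorem pr_majority_le [Nonempty Ω] {R : ℕ} {p : Ω → Prop} [DecidablePred p]
    (h : pr p ≤ 1 / 16) :
    pr (fun f : Fin R → Ω => R ≤ 2 * #{r | p (f r)}) ≤ (1 / 2) ^ R := by
  classical
  -- Exponential moment: φ is 16^(1_p)/4, with mean at most (1 + 15/16)/4 < 1/2, and a product of R
  -- copies is at least 1 once half of them are bad.
  let φ : Ω → ℝ := fun ω => (1 + 15 * if p ω then (1 : ℝ) else 0) / 4
  have h1 : 𝔼 ω, φ ω ≤ 1 / 2 := by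
    have : 𝔼 ω, φ ω = (1 + 15 * pr p) / 4 := by
      simp only [φ, pr]
      rw [← expect_div, expect_add_distrib, ← mul_expect]
      simp only [expect_const, univ_nonempty]
      congr! 4
      split_ifs <;> rfl
    linarith
  have h0 : 0 ≤ 𝔼 ω, φ ω := expect_nonneg fun ω _ => by
    simp only [φ]; split_ifs <;> norm_num
  have h2 : 𝔼 f : Fin R → Ω, ∏ r, φ (f r) = (𝔼 ω, φ ω) ^ R := by
    rw [Fintype.expect_eq_sum_div_card, Fintype.expect_eq_sum_div_card, div_pow, Fintype.sum_pow]
    simp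
  refine le_trans ?_ (h2.le.trans (pow_le_pow_left₀ h0 h1 R))
  refine expect_le_expect fun f _ => ?_
  have h3 : ∏ r, φ (f r) = 16 ^ #{r | p (f r)} / 4 ^ R := by
    simp only [φ]
    rw [prod_div_distrib]
    congr 1
    · rw [← prod_const, prod_filter]
      refine prod_congr rfl fun r _ => ?_
      split_ifs <;> norm_num
    · simp
  rw [h3]
  split_ifs with h4
  · rw [one_le_div (by positivity), show (16 : ℝ) = 4 ^ 2 by norm_num, ← pow_mul]
    exact pow_le_pow_right₀ (by norm_num) h4
  · positivity

end Probability

/-! ### Pairwise independence and random signs -/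

section RandomFunctions

variable {α β : Type*} [Fintype α] [DecidableEq α] [Fintype β] [Nonempty β]

/-- Resampling one value of a uniformly random function does not change expectations. -/
theorem expect_eq_expect_update (j : α) (F : (α → β) → ℝ) :
    𝔼 f, F f = 𝔼 f, 𝔼 z, F (Function.update f j z) := by
  have key : ∀ G : (α → β) → ℝ,
      𝔼 f, G f = 𝔼 r : {k // k ≠ j} → β, 𝔼 z, G ((Equiv.funSplitAt j β).symm (z, r)) := by
    intro G
    rw [expect_comm, ← expect_prod (fun w : β × ({k // k ≠ j} → β) =>
      G ((Equiv.funSplitAt j β).symm w))]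
    exact Fintype.expect_equiv (Equiv.funSplitAt j β) _ _ fun f =>
      congrArg G ((Equiv.funSplitAt j β).symm_apply_apply f).symm
  rw [key F, key fun f => 𝔼 z, F (Function.update f j z)]
  refine expect_congr rfl fun r _ => ?_
  have : ∀ z z' : β, Function.update ((Equiv.funSplitAt j β).symm (z, r)) j z'
      = (Equiv.funSplitAt j β).symm (z', r) := by
    intro z z'
    ext k
    by_cases hk : k = j
    · subst hk; simp [Equiv.funSplitAt, Equiv.piSplitAt]
    · simp [Equiv.funSplitAt, Equiv.piSplitAt, hk]
  simp [this]

/-- Resampling `f j` leaves `f i` untouched, so `f i` may be treated as fixed. -/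
theorem pr_pair_le {i j : α} (hij : i ≠ j) {p : β → β → Prop} {c : ℝ}
    (h : ∀ y, pr (fun z => p y z) ≤ c) : pr (fun f : α → β => p (f i) (f j)) ≤ c := by
  classical
  rw [pr, expect_eq_expect_update j]
  refine expect_le_const fun f => ?_
  simpa [hij, pr] using h (f i)

theorem pr_eq_le {i j : α} (hij : i ≠ j) :
    pr (fun f : α → β => f i = f j) ≤ 1 / Fintype.card β := by
  classical
  refine pr_pair_le (p := fun y z => y = z) hij fun y => le_of_eq ?_
  simp [pr]

/-- The sign encoded by a Boolean. -/
def sgn (b : Bool) : ℝ := if b then 1 else -1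

theorem sgn_mul_self (b : Bool) : sgn b * sgn b = 1 := by cases b <;> simp [sgn]

theorem abs_sgn (b : Bool) : |sgn b| = 1 := by cases b <;> simp [sgn]

theorem expect_sq_sum_sgn (a : α → ℝ) :
    𝔼 s : α → Bool, (∑ j, sgn (s j) * a j) ^ 2 = ∑ j, a j ^ 2 := by
  have hoff : ∀ i j : α, i ≠ j → 𝔼 s : α → Bool, sgn (s i) * sgn (s j) = 0 := by
    intro i j hij
    rw [expect_eq_expect_update j]
    refine expect_eq_zero fun f _ => ?_
    simp only [Function.update_self, Function.update_of_ne hij, ← mul_expect]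
    rw [Fintype.expect_eq_sum_div_card]
    simp [sgn]
  have h1 : ∀ s : α → Bool, (∑ j, sgn (s j) * a j) ^ 2
      = ∑ i, ∑ j, (a i * a j) * (sgn (s i) * sgn (s j)) := by
    intro s
    rw [sq, sum_mul_sum]
    exact sum_congr rfl fun i _ => sum_congr rfl fun j _ => by ring
  simp_rw [h1]
  rw [expect_sum_comm]
  refine sum_congr rfl fun i _ => ?_
  rw [expect_sum_comm, sum_eq_single i]
  · simp [sgn_mul_self, sq]
  · intro j _ hj
    rw [← mul_expect, hoff i j hj.symm, mul_zero]
  · simp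

end RandomFunctions

/-! ### Noise energy in a random class -/

section Noise

variable {ι κ : Type*} [Fintype ι] [DecidableEq κ]

/-- The energy of `y` in the class of coordinates labelled `b`. -/
def energy (β : ι → κ) (y : ι → ℝ) (b : κ) : ℝ := ∑ j, if β j = b then y j ^ 2 else 0

theorem energy_nonneg (β : ι → κ) (y : ι → ℝ) (b : κ) : 0 ≤ energy β y b :=
  sum_nonneg fun j _ => by split_ifs <;> positivity

theorem card_energy_gt_le [Fintype κ] (β : ι → κ) (y : ι → ℝ) {c N : ℝ} (hc : 0 < c)
    (hy : ∑ j, y j ^ 2 ≤ N * c) :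
    (#{b | c < energy β y b} : ℝ) ≤ N := by
  have h1 : ∑ b, energy β y b = ∑ j, y j ^ 2 := by
    simp only [energy]
    rw [sum_comm]
    simp
  have h2 : #{b | c < energy β y b} • c ≤ ∑ b ∈ ({b | c < energy β y b} : Finset κ), energy β y b :=
    card_nsmul_le_sum _ _ _ fun b hb => by
      simp only [mem_filter, mem_univ, true_and] at hb; exact hb.le
  have h3 : ∑ b ∈ ({b | c < energy β y b} : Finset κ), energy β y b ≤ ∑ b, energy β y b :=
    sum_le_sum_of_subset_of_nonneg (subset_univ _) fun b _ _ => energy_nonneg β y b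
  rw [nsmul_eq_mul] at h2
  exact le_of_mul_le_mul_right (by linarith) hc

variable [DecidableEq ι] {Γ : Type*} [Fintype Γ] [Nonempty Γ]

/-- The hypothesis `y i = 0` removes the one term whose collision with `i` is certain; every other
term collides with probability at most `p`. -/
theorem expect_energy_le (P : Γ → κ) {p : ℝ} (hp : ∀ y, pr (fun z => P z = P y) ≤ p) (y : ι → ℝ)
    {i : ι} (hi : y i = 0) :
    𝔼 f : ι → Γ, energy (fun j => P (f j)) y (P (f i)) ≤ p * ∑ j, y j ^ 2 := by
  classical
  simp only [energy]
  rw [expect_sum_comm, mul_sum]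
  refine sum_le_sum fun j _ => ?_
  by_cases hij : i = j
  · subst hij; simp [hi]
  · have h := pr_pair_le (β := Γ) hij (p := fun a b => P b = P a) hp
    calc 𝔼 f : ι → Γ, (if P (f j) = P (f i) then y j ^ 2 else 0)
        = pr (fun f : ι → Γ => P (f j) = P (f i)) * y j ^ 2 := by
          rw [pr, expect_mul]
          refine expect_congr rfl fun f _ => ?_
          split_ifs <;> simp
      _ ≤ _ := by gcongr

theorem pr_le_energy_le (P : Γ → κ) {p : ℝ} (hp : ∀ y, pr (fun z => P z = P y) ≤ p) (y : ι → ℝ)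
    {i : ι} (hi : y i = 0) {e : ℝ} (he : 0 < e) :
    pr (fun f : ι → Γ => e ≤ energy (fun j => P (f j)) y (P (f i))) ≤ p * (∑ j, y j ^ 2) / e :=
  (pr_le_expect_div (fun _ => energy_nonneg _ _ _) he).trans
    (by gcongr; exact expect_energy_le P hp y hi)

/-- Signed sums over the class of `i`, with coefficients `w` bounded by `D` on that class. -/
theorem pr_le_sq_sum_sgn_le (P : Γ → κ) {p : ℝ} (hp : ∀ y, pr (fun z => P z = P y) ≤ p)
    (w : Γ → Γ → ℝ) {D : ℝ} (hw : ∀ a b, P b = P a → w a b ^ 2 ≤ D) (y : ι → ℝ)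
    {i : ι} (hi : y i = 0) {e : ℝ} (he : 0 < e) (hD : 0 ≤ D) :
    pr (fun ω : (ι → Γ) × (ι → Bool) => e ≤ (∑ j, sgn (ω.2 j) *
      (if P (ω.1 j) = P (ω.1 i) then w (ω.1 i) (ω.1 j) * y j else 0)) ^ 2)
      ≤ D * p * (∑ j, y j ^ 2) / e := by
  refine (pr_le_expect_div (fun _ => sq_nonneg _) he).trans ?_
  gcongr
  rw [expect_prod]
  simp_rw [expect_sq_sum_sgn]
  calc 𝔼 f : ι → Γ, ∑ j, (if P (f j) = P (f i) then w (f i) (f j) * y j else 0) ^ 2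
      ≤ 𝔼 f : ι → Γ, D * energy (fun j => P (f j)) y (P (f i)) := by
        refine expect_le_expect fun f _ => ?_
        rw [energy, mul_sum]
        refine sum_le_sum fun j _ => ?_
        split_ifs with h
        · rw [mul_pow]; gcongr; exact hw _ _ h
        · simp
    _ ≤ _ := by
        rw [← mul_expect, mul_assoc]
        gcongr
        exact expect_energy_le P hp y hi

end Noise

/-! ### First round: hashing the buckets -/

section Sketch

variable {ι κ : Type*} [Fintype ι] {M : ℕ}

/-- The signed sum of the coordinates whose bucket is hashed to the cell `c`. -/
def cellSum (β : ι → κ) (w : (κ → Fin M) × (ι → Bool)) (x : ι → ℝ) (c : Fin M) : ℝ :=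
  ∑ j, (if w.1 (β j) = c then sgn (w.2 j) else 0) * x j

/-- A repetition misrepresents the bucket `b`: a heavy coordinate of another bucket lands in its
cell, or the light coordinates in its cell have a signed sum of size at least `δ`. -/
def BadRep (β : ι → κ) (H : Finset ι) (y : ι → ℝ) (δ : ℝ) (b : κ)
    (w : (κ → Fin M) × (ι → Bool)) : Prop :=
  (∃ j ∈ H, β j ≠ b ∧ w.1 (β j) = w.1 b) ∨ δ ^ 2 ≤ cellSum β w y (w.1 b) ^ 2

/-- A heavy coordinate of another bucket collides with probability 1/M. For the signed sum, Markov
is applied to its second moment: the bucket's own light energy is always present, that of the other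
buckets only with probability 1/M. -/
theorem pr_badRep_le [DecidableEq ι] [DecidableEq κ] [Fintype κ] [NeZero M] (β : ι → κ) (H : Finset ι) (y : ι → ℝ) {δ : ℝ} (hδ : 0 < δ) (b : κ) :
    pr (BadRep (M := M) β H y δ b)
      ≤ #H / M + (energy β y b + (∑ j, y j ^ 2) / M) / δ ^ 2 := by
  classical
  have hM : ∀ c : κ, c ≠ b → pr (fun g : κ → Fin M => g c = g b) ≤ 1 / M := fun c hc => by
    simpa using pr_eq_le (β := Fin M) hc
  refine (pr_or_le _ _).trans (add_le_add ?_ ?_)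
  · refine (pr_exists_le_card_mul H _ (c := 1 / M) fun j _ => ?_).trans (by simp [div_eq_mul_inv])
    refine pr_prod_le_of_snd fun s => ?_
    by_cases hj : β j = b
    · simp [hj, pr]
    · simpa [hj] using hM _ hj
  · refine (pr_le_expect_div (fun _ => sq_nonneg _) (by positivity)).trans ?_
    gcongr
    rw [expect_prod]
    have h1 : ∀ (g : κ → Fin M) (s : ι → Bool), cellSum β (g, s) y (g b)
        = ∑ j, sgn (s j) * (if g (β j) = g b then y j else 0) := fun g s =>
      sum_congr rfl fun j _ => by simp only; split_ifs <;> simp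
    simp_rw [h1, expect_sq_sum_sgn]
    rw [expect_sum_comm, energy, sum_div, ← sum_add_distrib]
    refine sum_le_sum fun j _ => ?_
    by_cases hj : β j = b
    · simp only [hj, if_true, expect_const univ_nonempty]
      have : 0 ≤ y j ^ 2 / M := by positivity
      linarith
    · simp only [hj, if_false, zero_add]
      calc 𝔼 g : κ → Fin M, (if g (β j) = g b then y j else 0) ^ 2
          = pr (fun g : κ → Fin M => g (β j) = g b) * y j ^ 2 := by
            rw [pr, expect_mul]
            refine expect_congr rfl fun f _ => ?_
            split_ifs <;> simp
        _ ≤ 1 / M * y j ^ 2 := by gcongr; exact hM _ hj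
        _ = _ := by ring

variable {R : ℕ} [Fintype κ]

/-- The buckets whose cell exceeds `t` in absolute value in more than half of the repetitions. -/
noncomputable def selected (g : Fin R → κ → Fin M) (z : Fin R × Fin M → ℝ) (t : ℝ) : Finset κ :=
  {b | R < 2 * #{r | t < |z (r, g r b)|}}

theorem selected_antitone (g : Fin R → κ → Fin M) (z : Fin R × Fin M → ℝ) :
    Antitone (selected g z) := by
  intro t t' h b hb
  simp only [selected, mem_filter, mem_univ, true_and] at hb ⊢
  refine hb.trans_le (Nat.mul_le_mul_left 2 (card_le_card fun r hr => ?_))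
  simp only [mem_filter, mem_univ, true_and] at hr ⊢
  exact h.trans_lt hr

-- The right threshold is unknown to the algorithm. Since the sets form a chain, the largest one of
-- size at most `L` contains all the others of such size, so one enumeration serves every threshold.
omit [Fintype κ] in
theorem exists_enumeration_of_antitone {S : ℝ → Finset κ} (hS : Antitone S) (L : ℕ) [Nonempty κ] :
    ∃ f : Fin L → κ, ∀ t, #(S t) ≤ L → ∀ b ∈ S t, ∃ l, f l = b := by
  classical
  by_cases hne : ∃ t, #(S t) ≤ L
  · obtain ⟨_, ⟨t₀, h₀, rfl⟩, hmax⟩ :=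
      Set.Finite.exists_maximalFor (fun c : ℕ => c) {c | ∃ t, #(S t) ≤ L ∧ #(S t) = c}
        ((Set.finite_Iic L).subset (by rintro _ ⟨t, h, rfl⟩; exact h))
        (by obtain ⟨t, h⟩ := hne; exact ⟨_, t, h, rfl⟩)
    have hsub : ∀ t, #(S t) ≤ L → S t ⊆ S t₀ := by
      intro t ht
      rcases le_total t₀ t with h | h
      · exact hS h
      · exact (eq_of_subset_of_card_le (hS h) (by
          have := @hmax #(S t) ⟨t, ht, rfl⟩ (card_le_card (hS h)); exact this)).ge
    refine ⟨fun l => if h : (l : ℕ) < #(S t₀) then (S t₀).equivFin.symm ⟨l, h⟩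
      else Classical.arbitrary κ, fun t ht b hb => ?_⟩
    let e := (S t₀).equivFin ⟨b, hsub t ht hb⟩
    exact ⟨⟨e, e.2.trans_le h₀⟩, by simp [e]⟩
  · exact ⟨fun _ => Classical.arbitrary κ, fun t ht => (hne ⟨t, ht⟩).elim⟩

section Correctness

variable {β : ι → κ} {H : Finset ι} {x y : ι → ℝ} {δ : ℝ} {b : κ}
  (hyH : ∀ j ∈ H, y j = 0) (hyx : ∀ j ∉ H, y j = x j)

omit [Fintype κ] in
include hyx in
theorem cellSum_eq_of_no_heavy {w : (κ → Fin M) × (ι → Bool)}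
    (hb : ∀ j ∈ H, β j ≠ b) (hw : ¬ BadRep β H y δ b w) :
    cellSum β w x (w.1 b) = cellSum β w y (w.1 b) := by
  refine sum_congr rfl fun j _ => ?_
  by_cases hj : j ∈ H
  · have h : w.1 (β j) ≠ w.1 b := fun h => hw (Or.inl ⟨j, hj, hb j hj, h⟩)
    simp [h]
  · rw [hyx j hj]

omit [Fintype κ] in
include hyH hyx in
theorem cellSum_eq_of_heavy {w : (κ → Fin M) × (ι → Bool)} {i : ι} (hi : i ∈ H)
    (hb : ∀ j ∈ H, β j = β i → j = i) (hw : ¬ BadRep β H y δ (β i) w) :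
    cellSum β w x (w.1 (β i)) = sgn (w.2 i) * x i + cellSum β w y (w.1 (β i)) := by
  classical
  unfold cellSum
  rw [← Finset.add_sum_erase _ _ (mem_univ i), ← Finset.add_sum_erase _ _ (mem_univ i)]
  simp only [if_true, hyH i hi, mul_zero, zero_add]
  congr 1
  refine sum_congr rfl fun j hj => ?_
  by_cases hjH : j ∈ H
  · have h : w.1 (β j) ≠ w.1 (β i) := fun h =>
      hw (Or.inl ⟨j, hjH, fun h' => (ne_of_mem_erase hj) (hb j hjH h'), h⟩)
    simp [h]
  · rw [hyx j hjH]

variable (hδ : 0 < δ) {ω : Fin R → (κ → Fin M) × (ι → Bool)} {z : Fin R × Fin M → ℝ}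
  (hz : ∀ r c, z (r, c) = cellSum β (ω r) x c)

open Classical in
include hyx hδ hz in
theorem notMem_selected (hb : ∀ j ∈ H, β j ≠ b)
    (hmaj : ¬ R ≤ 2 * #{r | BadRep β H y δ b (ω r)}) :
    b ∉ selected (fun r => (ω r).1) z δ := by
  simp only [selected, mem_filter, mem_univ, true_and, not_lt]
  refine le_trans (Nat.mul_le_mul_left 2 (card_le_card fun r hr => ?_)) (not_le.mp hmaj).le
  simp only [mem_filter, mem_univ, true_and] at hr ⊢
  by_contra hw
  rw [hz, cellSum_eq_of_no_heavy hyx hb hw] at hr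
  exact hw (Or.inr (sq_le_sq.mpr (by rw [abs_of_pos hδ]; exact hr.le)))

-- More than half of the repetitions are good, and in each of them the cell exceeds 2δ - δ in
-- absolute value.
open Classical in
include hyH hyx hδ hz in
theorem mem_selected {i : ι} (hi : i ∈ H) (hxi : 2 * δ ≤ |x i|)
    (hb : ∀ j ∈ H, β j = β i → j = i)
    (hmaj : ¬ R ≤ 2 * #{r | BadRep β H y δ (β i) (ω r)}) :
    β i ∈ selected (fun r => (ω r).1) z δ := by
  simp only [selected, mem_filter, mem_univ, true_and]
  have h1 : #{r | BadRep β H y δ (β i) (ω r)} + #{r | ¬ BadRep β H y δ (β i) (ω r)} = R := by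
    rw [card_filter_add_card_filter_not]; simp
  have h2 : #{r | ¬ BadRep β H y δ (β i) (ω r)} ≤ #{r | δ < |z (r, (ω r).1 (β i))|} := by
    refine card_le_card fun r hr => ?_
    simp only [mem_filter, mem_univ, true_and] at hr ⊢
    rw [hz, cellSum_eq_of_heavy hyH hyx hi hb hr]
    have h3 : |cellSum β (ω r) y ((ω r).1 (β i))| < δ := by
      by_contra h
      exact hr (Or.inr (sq_le_sq.mpr (by rw [abs_of_pos hδ]; exact not_lt.mp h)))
    have h4 : |sgn ((ω r).2 i) * x i| = |x i| := by rw [abs_mul, abs_sgn, one_mul]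
    have h5 := abs_sub_abs_le_abs_sub (sgn ((ω r).2 i) * x i)
      (-cellSum β (ω r) y ((ω r).1 (β i)))
    rw [sub_neg_eq_add, abs_neg, h4] at h5
    linarith
  omega

open Classical in
include hyx hδ hz in
/-- If every bucket of small energy is represented correctly, few buckets are selected. -/
theorem card_selected_le [DecidableEq κ] {c N : ℝ} (hc : 0 < c) (hy : ∑ j, y j ^ 2 ≤ N * c)
    (hmaj : ∀ b, energy β y b ≤ c → ¬ R ≤ 2 * #{r | BadRep β H y δ b (ω r)}) :
    (#(selected (fun r => (ω r).1) z δ) : ℝ) ≤ #H + N := by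
  have hsub : selected (fun r => (ω r).1) z δ ⊆ H.image β ∪ ({b | c < energy β y b} : Finset κ) := by
    intro b hb
    simp only [mem_union, mem_image, mem_filter, mem_univ, true_and]
    by_contra hcon
    push Not at hcon
    exact notMem_selected hyx hδ hz hcon.1 (hmaj b hcon.2) hb
  have h1 := (card_le_card hsub).trans (card_union_le _ _)
  have h2 : #(H.image β) ≤ #H := card_image_le
  have h3 := card_energy_gt_le β y hc hy
  have h4 : (#(selected (fun r => (ω r).1) z δ) : ℝ) ≤ #H + #{b | c < energy β y b} := by
    exact_mod_cast h1.trans (by omega)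
  linarith

end Correctness

end Sketch

/-! ### Growth of the known label prefixes -/

section Levels

/-- The number of base-`m` digits of the labels that are known after `t` rounds. -/
def level : ℕ → ℕ
  | 0 => 6
  | t + 1 => (3 * level t - 2) / 2

theorem six_le_level (t : ℕ) : 6 ≤ level t := by
  induction t with
  | zero => simp [level]
  | succ t ih => simp only [level]; omega

theorem level_le_succ (t : ℕ) : level t ≤ level (t + 1) := by
  have := six_le_level t
  simp only [level]; omega

theorem level_mono : Monotone level := monotone_nat_of_le_succ level_le_succ

/-- This makes the noise factor m^(2(c'-c)) · m^(-c) at most m^(-2) when c and c' are consecutive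
levels. -/
theorem two_mul_level_succ_le (t : ℕ) : 2 * level (t + 1) + 2 ≤ 3 * level t := by
  have := six_le_level t
  simp only [level]; omega

/-- The rate 5/4 absorbs the rounding in the recursion, which is possible as soon as the level is at
least 6. -/
theorem six_mul_pow_le_level (t : ℕ) : 6 * (5 / 4 : ℝ) ^ t ≤ level t := by
  induction t with
  | zero => simp [level]
  | succ t ih =>
    have h6 := six_le_level t
    have h : 5 * level t ≤ 4 * level (t + 1) := by simp only [level]; omega
    have h' : (5 : ℝ) * level t ≤ 4 * level (t + 1) := by exact_mod_cast h
    rw [pow_succ]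
    linarith

/-- The first `c` base-`m` digits of an `E`-digit number. -/
def pre (m E c y : ℕ) : ℕ := y / m ^ (E - c)

theorem pre_eq_div {m E c c' : ℕ} (h : c ≤ c') (h' : c' ≤ E) (y : ℕ) :
    pre m E c y = pre m E c' y / m ^ (c' - c) := by
  rw [pre, pre, Nat.div_div_eq_div_mul, ← pow_add]
  congr 2
  omega

theorem pre_self (m E y : ℕ) : pre m E E y = y := by simp [pre]

theorem pre_lt {m E c y : ℕ} (h : c ≤ E) (hy : y < m ^ E) : pre m E c y < m ^ c := by
  apply Nat.div_lt_of_lt_mul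
  rwa [← pow_add, Nat.sub_add_cancel h]

/-- Numbers with the same quotient by m^(c'-c) lie in one interval of that length. This bounds the
weights of the noise in a refinement round. -/
theorem sq_sub_pre_le {m E c c' : ℕ} (h : c ≤ c') (h' : c' ≤ E) (hm : 0 < m) {y z : ℕ}
    (hyz : pre m E c z = pre m E c y) :
    ((pre m E c' z : ℝ) - pre m E c' y) ^ 2 ≤ ((m : ℝ) ^ (c' - c)) ^ 2 := by
  rw [pre_eq_div h h', pre_eq_div h h' y] at hyz
  have hD : 0 < m ^ (c' - c) := by positivity
  have h1 := Nat.div_mul_le_self (pre m E c' z) (m ^ (c' - c))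
  have h2 := Nat.div_mul_le_self (pre m E c' y) (m ^ (c' - c))
  have h3 := Nat.lt_div_mul_add (a := pre m E c' z) hD
  have h4 := Nat.lt_div_mul_add (a := pre m E c' y) hD
  rw [hyz] at h1 h3
  have h5 : pre m E c' z ≤ pre m E c' y + m ^ (c' - c) := by linarith
  have h6 : pre m E c' y ≤ pre m E c' z + m ^ (c' - c) := by linarith
  have h5' : (pre m E c' z : ℝ) ≤ pre m E c' y + (m : ℝ) ^ (c' - c) := by exact_mod_cast h5
  have h6' : (pre m E c' y : ℝ) ≤ pre m E c' z + (m : ℝ) ^ (c' - c) := by exact_mod_cast h6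
  apply sq_le_sq'  <;> linarith

theorem pr_pre_eq_le {m E c : ℕ} (hm : 0 < m) (h : c ≤ E) (y : Fin (m ^ E)) :
    pr (fun z : Fin (m ^ E) => pre m E c z = pre m E c y) ≤ 1 / (m : ℝ) ^ c := by
  classical
  have hm' : (0 : ℝ) < m := by exact_mod_cast hm
  have hD : 0 < m ^ (E - c) := by positivity
  have hcard : #{z : Fin (m ^ E) | pre m E c z = pre m E c y} ≤ m ^ (E - c) := by
    calc #{z : Fin (m ^ E) | pre m E c z = pre m E c y}
        = #(({z : Fin (m ^ E) | pre m E c z = pre m E c y} : Finset (Fin (m ^ E))).map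
            Fin.valEmbedding) := by rw [card_map]
      _ ≤ #(Finset.Ico (pre m E c y * m ^ (E - c)) (pre m E c y * m ^ (E - c) + m ^ (E - c))) := by
          refine card_le_card fun k hk => ?_
          simp only [mem_map, mem_filter, mem_univ, true_and] at hk
          obtain ⟨z, hz, rfl⟩ := hk
          rw [← hz, mem_Ico]
          exact ⟨Nat.div_mul_le_self _ _, Nat.lt_div_mul_add hD⟩
      _ = _ := by simp
  rw [pr_eq_card_div, Fintype.card_fin, Nat.cast_pow,
    div_le_div_iff₀ (by positivity) (by positivity), one_mul]
  calc _ ≤ (m ^ (E - c) : ℝ) * m ^ c := by gcongr; exact_mod_cast hcard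
    _ = _ := by rw [← pow_add, Nat.sub_add_cancel h]

end Levels

/-! ### Refinement rounds and exact reading -/

section Rounds

variable {n : ℕ} {ι : Type*} [Fintype ι]

/-- One round of measurements indexed by an arbitrary finite type. -/
noncomputable def measureOn (A : Matrix ι (Fin n) ℝ) (next : (ι → ℝ) → AdaptiveAlgorithm n) :
    AdaptiveAlgorithm n :=
  .measure (Fintype.card ι) (A.submatrix (Fintype.equivFin ι).symm id)
    fun y => next (y ∘ Fintype.equivFin ι)

theorem submatrix_mulVec_comp (A : Matrix ι (Fin n) ℝ) (x : Fin n → ℝ) :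
    (A.submatrix (Fintype.equivFin ι).symm id).mulVec x ∘ Fintype.equivFin ι = A.mulVec x := by
  ext k
  simp [Matrix.mulVec, dotProduct]

theorem run_measureOn (A : Matrix ι (Fin n) ℝ) (next : (ι → ℝ) → AdaptiveAlgorithm n)
    (x : EuclideanSpace ℝ (Fin n)) :
    (measureOn A next).run x = (next (A.mulVec x.ofLp)).run x := by
  rw [measureOn, AdaptiveAlgorithm.run, submatrix_mulVec_comp]

theorem numMeasurements_measureOn (A : Matrix ι (Fin n) ℝ)
    (next : (ι → ℝ) → AdaptiveAlgorithm n) (x : EuclideanSpace ℝ (Fin n)) :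
    (measureOn A next).numMeasurements x
      = Fintype.card ι + (next (A.mulVec x.ofLp)).numMeasurements x := by
  rw [measureOn, AdaptiveAlgorithm.numMeasurements, submatrix_mulVec_comp]

theorem numRounds_measureOn (A : Matrix ι (Fin n) ℝ)
    (next : (ι → ℝ) → AdaptiveAlgorithm n) (x : EuclideanSpace ℝ (Fin n)) :
    (measureOn A next).numRounds x = 1 + (next (A.mulVec x.ofLp)).numRounds x := by
  rw [measureOn, AdaptiveAlgorithm.numRounds, submatrix_mulVec_comp]

variable {L : ℕ}

open Classical in
/-- Observe the coordinates `cand l` and output them, with zeros elsewhere. -/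
noncomputable def readCoords (cand : Fin L → Fin n) : AdaptiveAlgorithm n :=
  measureOn (Matrix.of fun l j => if j = cand l then 1 else 0) fun y =>
    .output (WithLp.toLp 2 fun i => if h : ∃ l, cand l = i then y h.choose else 0)

open Classical in
theorem run_readCoords (cand : Fin L → Fin n) (x : EuclideanSpace ℝ (Fin n)) (i : Fin n) :
    (readCoords cand).run x i = if ∃ l, cand l = i then x i else 0 := by
  rw [readCoords, run_measureOn, AdaptiveAlgorithm.run]
  simp only [Matrix.mulVec, dotProduct, Matrix.of_apply, ite_mul, one_mul, zero_mul, sum_ite_eq', mem_univ,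
    if_true]
  split_ifs with h
  · simp [h.choose_spec]
  · rfl

theorem numMeasurements_readCoords (cand : Fin L → Fin n) (x : EuclideanSpace ℝ (Fin n)) :
    (readCoords cand).numMeasurements x = L := by
  simp [readCoords, numMeasurements_measureOn, AdaptiveAlgorithm.numMeasurements]

theorem numRounds_readCoords (cand : Fin L → Fin n) (x : EuclideanSpace ℝ (Fin n)) :
    (readCoords cand).numRounds x = 1 := by
  simp [readCoords, numRounds_measureOn, AdaptiveAlgorithm.numRounds]

/-- For every slot, the signed sum over the coordinates in its class, plain (`false`) and weighted
by the labels `Q` (`true`). -/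
def slotMatrix (P Q : Fin n → ℕ) (s : Fin n → Bool) (q : Fin L → ℕ) :
    Matrix (Fin L × Bool) (Fin n) ℝ :=
  fun lb j => if P j = q lb.1 then (if lb.2 then sgn (s j) * Q j else sgn (s j)) else 0

/-- The label nearest to the ratio of the two measurements of a slot. -/
noncomputable def decode (u v : ℝ) : ℕ := (round (v / u)).toNat

/-- `f` rounds of refinement of the classes of the slots, followed by `final`. -/
noncomputable def refineSlots (P : ℕ → Fin n → ℕ) (s : Fin n → Bool)
    (final : (Fin L → ℕ) → AdaptiveAlgorithm n) : ℕ → ℕ → (Fin L → ℕ) → AdaptiveAlgorithm n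
  | 0, _, q => final q
  | f + 1, t, q => measureOn (slotMatrix (P t) (P (t + 1)) s q) fun y =>
      refineSlots P s final f (t + 1) fun l => decode (y (l, false)) (y (l, true))

theorem numMeasurements_refineSlots_le {P : ℕ → Fin n → ℕ} {s : Fin n → Bool}
    {final : (Fin L → ℕ) → AdaptiveAlgorithm n} {x : EuclideanSpace ℝ (Fin n)} {N : ℕ}
    (h : ∀ q, (final q).numMeasurements x ≤ N) (f t : ℕ) (q : Fin L → ℕ) :
    (refineSlots P s final f t q).numMeasurements x ≤ f * (L * 2) + N := by
  induction f generalizing t q with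
  | zero => simpa [refineSlots] using h q
  | succ f ih =>
    rw [refineSlots, numMeasurements_measureOn]
    refine (Nat.add_le_add_left (ih _ _) _).trans (le_of_eq ?_)
    simp only [Fintype.card_prod, Fintype.card_fin, Fintype.card_bool]
    ring

theorem numRounds_refineSlots_le {P : ℕ → Fin n → ℕ} {s : Fin n → Bool}
    {final : (Fin L → ℕ) → AdaptiveAlgorithm n} {x : EuclideanSpace ℝ (Fin n)} {N : ℕ}
    (h : ∀ q, (final q).numRounds x ≤ N) (f t : ℕ) (q : Fin L → ℕ) :
    (refineSlots P s final f t q).numRounds x ≤ f + N := by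
  induction f generalizing t q with
  | zero => simpa [refineSlots] using h q
  | succ f ih =>
    rw [refineSlots, numRounds_measureOn]
    have := ih (t + 1) fun l => decode ((slotMatrix (P t) (P (t + 1)) s q).mulVec x.ofLp (l, false))
      ((slotMatrix (P t) (P (t + 1)) s q).mulVec x.ofLp (l, true))
    omega

theorem decode_eq {u v δ : ℝ} {q : ℕ} (hδ : 0 < δ) (hu : δ < |u|) (hv : |v - q * u| < δ / 2) :
    decode u v = q := by
  have hu0 : u ≠ 0 := by
    rintro rfl
    simp only [abs_zero] at hu
    linarith
  have h1 : |v / u - q| < 1 / 2 := by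
    rw [show v / u - q = (v - q * u) / u by field_simp, abs_div, div_lt_iff₀ (by linarith)]
    linarith
  have h2 : round (v / u) = (q : ℤ) := by
    rw [round_eq, Int.floor_eq_iff]
    rw [abs_lt] at h1
    push_cast
    constructor <;> linarith
  rw [decode, h2, Int.toNat_natCast]

/-- Subtracting `Q i` times the plain sum from the weighted one cancels the heavy coordinate
exactly. What remains is noise with weights `Q j - Q i`, small within a class even though the labels
themselves are large. -/
theorem decode_slot_eq {P Q : Fin n → ℕ} {s : Fin n → Bool} {x y : Fin n → ℝ}
    {H : Finset (Fin n)} {δ : ℝ} (hδ : 0 < δ)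
    (hyH : ∀ j ∈ H, y j = 0) (hyx : ∀ j ∉ H, y j = x j) {i : Fin n} (hi : i ∈ H)
    (hxi : 2 * δ ≤ |x i|) (hP : ∀ j ∈ H, P j = P i → j = i)
    (hU : |∑ j, sgn (s j) * (if P j = P i then y j else 0)| < δ)
    (hV : |∑ j, sgn (s j) * (if P j = P i then ((Q j : ℝ) - Q i) * y j else 0)| < δ / 2)
    {q : Fin L → ℕ} {l : Fin L} (hq : q l = P i) :
    decode ((slotMatrix P Q s q).mulVec x (l, false)) ((slotMatrix P Q s q).mulVec x (l, true))
      = Q i := by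
  have hterm : ∀ j ∈ Finset.univ.erase i, P j = P i → x j = y j := by
    intro j hj h
    have : j ∉ H := fun hjH => ne_of_mem_erase hj (hP j hjH h)
    rw [hyx j this]
  have hu : (slotMatrix P Q s q).mulVec x (l, false)
      = sgn (s i) * x i + ∑ j, sgn (s j) * (if P j = P i then y j else 0) := by
    simp only [slotMatrix, Matrix.mulVec, dotProduct, hq]
    rw [show sgn (s i) * x i = ∑ j, if j = i then sgn (s j) * x j else 0 by simp,
      ← sum_add_distrib]
    refine sum_congr rfl fun j _ => ?_
    by_cases h : P j = P i
    · by_cases hj : j = i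
      · subst hj; simp [hyH j hi]
      · simp [h, hj, hterm j (by simp [hj]) h]
    · have hj : j ≠ i := fun hj => h (by rw [hj])
      simp [h, hj]
  have hv : (slotMatrix P Q s q).mulVec x (l, true) - Q i * (slotMatrix P Q s q).mulVec x (l, false)
      = ∑ j, sgn (s j) * (if P j = P i then ((Q j : ℝ) - Q i) * y j else 0) := by
    simp only [slotMatrix, Matrix.mulVec, dotProduct, hq]
    rw [mul_sum, ← sum_sub_distrib]
    refine sum_congr rfl fun j _ => ?_
    by_cases h : P j = P i
    · by_cases hj : j = i
      · subst hj; simp only [if_true, sub_self, zero_mul, mul_zero]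
        simp; ring
      · rw [← hterm j (by simp [hj]) h]
        simp [h]; ring
    · simp [h]
  refine decode_eq hδ ?_ (by rwa [hv])
  rw [hu]
  have h4 : |sgn (s i) * x i| = |x i| := by rw [abs_mul, abs_sgn, one_mul]
  have h5 := abs_sub_abs_le_abs_sub (sgn (s i) * x i)
    (-∑ j, sgn (s j) * (if P j = P i then y j else 0))
  rw [sub_neg_eq_add, abs_neg, h4] at h5
  linarith

/-- Slots that track no element of `G` may evolve arbitrarily. With `G` empty this still says that
every run ends in some `final`. -/
theorem exists_run_refineSlots_eq {P : ℕ → Fin n → ℕ} {s : Fin n → Bool}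
    (final : (Fin L → ℕ) → AdaptiveAlgorithm n) (x : EuclideanSpace ℝ (Fin n))
    (G : Set (Fin n)) (f t : ℕ) (q : Fin L → ℕ)
    (h : ∀ t' < t + f, ∀ i ∈ G, ∀ (q : Fin L → ℕ) l, q l = P t' i →
      decode ((slotMatrix (P t') (P (t' + 1)) s q).mulVec x.ofLp (l, false))
        ((slotMatrix (P t') (P (t' + 1)) s q).mulVec x.ofLp (l, true)) = P (t' + 1) i) :
    ∃ q', (refineSlots P s final f t q).run x = (final q').run x ∧
      ∀ i ∈ G, ∀ l, q l = P t i → q' l = P (t + f) i := by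
  induction f generalizing t q with
  | zero => exact ⟨q, rfl, fun i _ l hl => hl⟩
  | succ f ih =>
    obtain ⟨q', h1, h2⟩ := ih (t + 1)
      (fun l => decode ((slotMatrix (P t) (P (t + 1)) s q).mulVec x.ofLp (l, false))
        ((slotMatrix (P t) (P (t + 1)) s q).mulVec x.ofLp (l, true)))
      (fun t' ht' => h t' (by omega))
    refine ⟨q', by rw [refineSlots, run_measureOn, h1], fun i hi l hl => ?_⟩
    rw [h2 i hi l (h t (by omega) i hi q l hl)]
    congr 1
    omega

end Rounds

/-! ### The algorithm and its failure probability -/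

section Recover

variable {n m T R M : ℕ}

/-- The random choices: labels and signs for the refinement rounds, and for every repetition of
the first round a hash function on the buckets and signs. -/
abbrev Seed (n m T R M : ℕ) : Type :=
  ((Fin n → Fin (m ^ level T)) × (Fin n → Bool)) ×
    (Fin R → (Fin (m ^ 6) → Fin M) × (Fin n → Bool))

/-- The bucket of a label is given by its first six digits. -/
def bucket (y : Fin (m ^ level T)) : Fin (m ^ 6) :=
  ⟨pre m (level T) 6 y, pre_lt (six_le_level T) y.2⟩

theorem bucket_eq_of_pre_eq {y z : Fin (m ^ level T)} {t : ℕ} (ht : t ≤ T)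
    (h : pre m (level T) (level t) y = pre m (level T) (level t) z) : bucket y = bucket z := by
  refine Fin.ext ?_
  simp only [bucket]
  rw [pre_eq_div (six_le_level t) (level_mono ht), h,
    ← pre_eq_div (six_le_level t) (level_mono ht)]

/-- The measurements of the first round. -/
def sketchMatrix {κ : Type*} (β : Fin n → κ) [DecidableEq (Fin M)]
    (w : Fin R → (κ → Fin M) × (Fin n → Bool)) :
    Matrix (Fin R × Fin M) (Fin n) ℝ :=
  Matrix.of fun rc j => if (w rc.1).1 (β j) = rc.2 then sgn ((w rc.1).2 j) else 0

open Classical in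
/-- A coordinate with the given label. -/
noncomputable def coordWithLabel [NeZero n] (lab : Fin n → ℕ) (q : ℕ) : Fin n :=
  if h : ∃ j, lab j = q then h.choose else 0

/-- The selected buckets, enumerated in `L` slots. -/
noncomputable def slots [NeZero m] (L : ℕ) (g : Fin R → Fin (m ^ 6) → Fin M)
    (z : Fin R × Fin M → ℝ) (l : Fin L) : ℕ :=
  (exists_enumeration_of_antitone (selected_antitone g z) L).choose l

theorem exists_slots_eq [NeZero m] {L : ℕ} {g : Fin R → Fin (m ^ 6) → Fin M}
    {z : Fin R × Fin M → ℝ} {t : ℝ} (h : #(selected g z t) ≤ L) {b : Fin (m ^ 6)}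
    (hb : b ∈ selected g z t) : ∃ l, slots L g z l = b := by
  obtain ⟨l, hl⟩ :=
    (exists_enumeration_of_antitone (selected_antitone g z) L).choose_spec t h b hb
  exact ⟨l, by rw [slots, hl]⟩

/-- The deterministic recovery algorithm given by a seed. -/
noncomputable def recover [NeZero n] [NeZero m] (L : ℕ) (ω : Seed n m T R M) :
    AdaptiveAlgorithm n :=
  measureOn (sketchMatrix (fun j => bucket (ω.1.1 j)) ω.2) fun z =>
    refineSlots (fun t j => pre m (level T) (level t) (ω.1.1 j)) ω.1.2
      (fun q : Fin L → ℕ => readCoords fun l => coordWithLabel (fun j => ω.1.1 j) (q l))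
      T 0 (slots L (fun r => (ω.2 r).1) z)

variable [NeZero n] [NeZero m]

theorem numMeasurements_recover_le (L : ℕ) (ω : Seed n m T R M) (x : EuclideanSpace ℝ (Fin n)) :
    (recover L ω).numMeasurements x ≤ R * M + T * (L * 2) + L := by
  rw [recover, numMeasurements_measureOn, Fintype.card_prod, Fintype.card_fin, Fintype.card_fin,
    add_assoc]
  exact Nat.add_le_add_left
    (numMeasurements_refineSlots_le (fun q => (numMeasurements_readCoords _ x).le) _ _ _) _

theorem numRounds_recover_le (L : ℕ) (ω : Seed n m T R M) (x : EuclideanSpace ℝ (Fin n)) :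
    (recover L ω).numRounds x ≤ T + 2 := by
  rw [recover, numRounds_measureOn]
  have := numRounds_refineSlots_le (P := fun t j => pre m (level T) (level t) (ω.1.1 j))
    (s := ω.1.2)
    (final := fun q : Fin L → ℕ => readCoords fun l => coordWithLabel (fun j => ω.1.1 j) (q l))
    (x := x) (N := 1) (fun q => (numRounds_readCoords _ x).le) T 0 (slots L (fun r => (ω.2 r).1)
      ((sketchMatrix (fun j => bucket (ω.1.1 j)) ω.2).mulVec x.ofLp))
  omega

theorem exists_run_recover_eq_readCoords (L : ℕ) (ω : Seed n m T R M)
    (x : EuclideanSpace ℝ (Fin n)) :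
    ∃ cand : Fin L → Fin n, (recover L ω).run x = (readCoords cand).run x := by
  obtain ⟨q', h, -⟩ := exists_run_refineSlots_eq
    (P := fun t j => pre m (level T) (level t) (ω.1.1 j)) (s := ω.1.2)
    (fun q : Fin L → ℕ => readCoords fun l => coordWithLabel (fun j => ω.1.1 j) (q l)) x ∅ T 0
    (slots L (fun r => (ω.2 r).1)
      ((sketchMatrix (fun j => bucket (ω.1.1 j)) ω.2).mulVec x.ofLp)) (by simp)
  exact ⟨_, by rw [recover, run_measureOn, h]⟩

theorem run_recover_eq_or (L : ℕ) (ω : Seed n m T R M) (x : EuclideanSpace ℝ (Fin n))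
    (i : Fin n) : (recover L ω).run x i = x i ∨ (recover L ω).run x i = 0 := by
  classical
  obtain ⟨cand, h⟩ := exists_run_recover_eq_readCoords L ω x
  rw [h, run_readCoords]
  split_ifs <;> simp

/-- The labels and signs fail the coordinate `i`: its bucket holds another heavy coordinate or too
much energy, one of its refinement steps is too noisy, or its label is not unique. -/
def BadLabels (H : Finset (Fin n)) (y : Fin n → ℝ) (δ : ℝ) (i : Fin n)
    (ω : (Fin n → Fin (m ^ level T)) × (Fin n → Bool)) : Prop :=
  (∃ j ∈ H.erase i, bucket (ω.1 i) = bucket (ω.1 j)) ∨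
  δ ^ 2 / 32 ≤ energy (fun j => bucket (ω.1 j)) y (bucket (ω.1 i)) ∨
  (∃ t ∈ range T, δ ^ 2 ≤ (∑ j, sgn (ω.2 j) *
    (if pre m (level T) (level t) (ω.1 j) = pre m (level T) (level t) (ω.1 i) then 1 * y j
      else 0)) ^ 2) ∨
  (∃ t ∈ range T, (δ / 2) ^ 2 ≤ (∑ j, sgn (ω.2 j) *
    (if pre m (level T) (level t) (ω.1 j) = pre m (level T) (level t) (ω.1 i) then
      ((pre m (level T) (level (t + 1)) (ω.1 j) : ℝ)
        - pre m (level T) (level (t + 1)) (ω.1 i)) * y j else 0)) ^ 2) ∨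
  ∃ j ∈ Finset.univ.erase i, ω.1 i = ω.1 j

section Analysis

variable {H : Finset (Fin n)} {x : EuclideanSpace ℝ (Fin n)} {y : Fin n → ℝ} {δ : ℝ} {K : ℕ}

open Classical in
theorem run_recover_eq (hδ : 0 < δ) (hyH : ∀ j ∈ H, y j = 0) (hyx : ∀ j ∉ H, y j = x j)
    (hx : ∀ i ∈ H, 2 * δ ≤ |x i|) (hH : #H ≤ 2 * K) (hy : ∑ j, y j ^ 2 ≤ 8 * K * δ ^ 2)
    {ω : Seed n m T R M} (h1 : ∀ i ∈ H, ¬ BadLabels H y δ i ω.1)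
    (h2 : ∀ b, energy (fun j => bucket (ω.1.1 j)) y b ≤ δ ^ 2 / 32 →
      ¬ R ≤ 2 * #{r | BadRep (fun j => bucket (ω.1.1 j)) H y δ b (ω.2 r)})
    {i : Fin n} (hi : i ∈ H) : (recover (258 * K) ω).run x i = x i := by
  have hA : ∀ i ∈ H, ∀ j ∈ H, bucket (ω.1.1 j) = bucket (ω.1.1 i) → j = i := by
    intro i hi j hj h
    by_contra hne
    exact h1 i hi (Or.inl ⟨j, by simp [hne, hj], h.symm⟩)
  set z := (sketchMatrix (fun j => bucket (ω.1.1 j)) ω.2).mulVec x.ofLp with hzdef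
  have hz : ∀ r c, z (r, c) = cellSum (fun j => bucket (ω.1.1 j)) (ω.2 r) x.ofLp c :=
    fun r c => rfl
  have hcard : #(selected (fun r => (ω.2 r).1) z δ) ≤ 258 * K := by
    -- At most 8Kδ² / (δ²/32) = 256K buckets have large energy; together with the 2K heavy ones this
    -- gives the 258K slots.
    have := card_selected_le (N := 256 * K) hyx hδ hz (by positivity : 0 < δ ^ 2 / 32)
      (by linarith) h2
    have hH' : (#H : ℝ) ≤ 2 * K := by exact_mod_cast hH
    have h3 : (#(selected (fun r => (ω.2 r).1) z δ) : ℝ) ≤ (258 * K : ℕ) := by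
      push_cast; linarith
    exact_mod_cast h3
  have hE : ∀ i ∈ H, energy (fun j => bucket (ω.1.1 j)) y (bucket (ω.1.1 i)) ≤ δ ^ 2 / 32 := by
    intro i hi
    by_contra h
    exact h1 i hi (Or.inr (Or.inl (not_le.mp h).le))
  have hsel := mem_selected hyH hyx hδ hz hi (hx i hi) (hA i hi) (h2 _ (hE i hi))
  obtain ⟨l, hl⟩ := exists_slots_eq hcard hsel
  obtain ⟨q', hrun, hq'⟩ := exists_run_refineSlots_eq
    (P := fun t j => pre m (level T) (level t) (ω.1.1 j)) (s := ω.1.2)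
    (fun q : Fin (258 * K) → ℕ => readCoords fun l => coordWithLabel (fun j => ω.1.1 j) (q l))
    x H T 0 (slots (258 * K) (fun r => (ω.2 r).1) z) (by
      intro t ht i hi q l hq
      rw [zero_add] at ht
      refine decode_slot_eq hδ hyH hyx hi (hx i hi) ?_ ?_ ?_ hq
      · exact fun j hj h => hA i hi j hj (bucket_eq_of_pre_eq ht.le h)
      · by_contra h
        refine h1 i hi (Or.inr (Or.inr (Or.inl ⟨t, mem_range.mpr ht, ?_⟩)))
        simp only [one_mul]
        exact sq_le_sq.mpr (by rw [abs_of_pos hδ]; exact not_lt.mp h)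
      · by_contra h
        refine h1 i hi (Or.inr (Or.inr (Or.inr (Or.inl ⟨t, mem_range.mpr ht, ?_⟩))))
        exact sq_le_sq.mpr (by rw [abs_of_pos (half_pos hδ)]; exact not_lt.mp h))
  have hlab : q' l = ω.1.1 i := by
    rw [hq' i hi l hl, zero_add, pre_self]
  have hcand : coordWithLabel (fun j => (ω.1.1 j : ℕ)) (q' l) = i := by
    have hex : ∃ j, (ω.1.1 j : ℕ) = q' l := ⟨i, hlab.symm⟩
    rw [coordWithLabel, dif_pos hex]
    by_contra hne
    refine h1 i hi (Or.inr (Or.inr (Or.inr (Or.inr ⟨_, mem_erase.mpr ⟨hne, mem_univ _⟩, ?_⟩))))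
    exact Fin.ext (hlab.symm.trans hex.choose_spec.symm)
  rw [recover, run_measureOn, hrun, run_readCoords, if_pos ⟨l, hcand⟩]

omit [NeZero n] in
theorem pr_badLabels_le (hδ : 0 < δ) (hyH : ∀ j ∈ H, y j = 0) (hH : #H ≤ 2 * K) (hK : 1 ≤ K)
    (hy : ∑ j, y j ^ 2 ≤ 8 * K * δ ^ 2) (hn : n * m ^ 2 ≤ m ^ level T) {i : Fin n} (hi : i ∈ H) :
    pr (BadLabels (T := T) (m := m) H y δ i) ≤ K * (259 + 40 * T) / (m : ℝ) ^ 2 := by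
  have hm0 : 0 < m := NeZero.pos m
  have hm : (1 : ℝ) ≤ m := by exact_mod_cast hm0
  have hpow : ∀ c, 2 ≤ c → 1 / (m : ℝ) ^ c ≤ 1 / (m : ℝ) ^ 2 := fun c hc =>
    one_div_le_one_div_of_le (by positivity) (pow_le_pow_right₀ hm hc)
  have hpre : ∀ t ≤ T, ∀ a : Fin (m ^ level T), pr (fun b : Fin (m ^ level T) =>
      pre m (level T) (level t) b = pre m (level T) (level t) a) ≤ 1 / (m : ℝ) ^ level t :=
    fun t ht a => pr_pre_eq_le hm0 (level_mono ht) a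
  have hbucket : ∀ a : Fin (m ^ level T), pr (fun b : Fin (m ^ level T) => bucket b = bucket a)
      ≤ 1 / (m : ℝ) ^ 2 := fun a => by
    refine (le_of_eq ?_).trans ((hpre 0 (Nat.zero_le _) a).trans (hpow _ (by simp [level])))
    simp only [bucket, Fin.mk.injEq, level]
  have hyi := hyH i hi
  have hH' : (#H : ℝ) ≤ 2 * K := by exact_mod_cast hH
  have hK' : (1 : ℝ) ≤ K := by exact_mod_cast hK
  set p : ℝ := 1 / (m : ℝ) ^ 2 with hp
  have hp0 : 0 < p := by positivity
  have h1 : pr (fun ω : (Fin n → Fin (m ^ level T)) × (Fin n → Bool) =>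
      ∃ j ∈ H.erase i, bucket (ω.1 i) = bucket (ω.1 j)) ≤ 2 * K * p := by
    refine (pr_exists_le_card_mul _ _ (c := p) fun j hj => ?_).trans ?_
    · refine pr_prod_le_of_snd fun s => ?_
      exact pr_pair_le (p := fun a b => bucket a = bucket b) (ne_of_mem_erase hj).symm
        fun a => by simpa only [eq_comm] using hbucket a
    · have : (#(H.erase i) : ℝ) ≤ #H := by exact_mod_cast card_erase_le
      gcongr
      linarith
  have h2 : pr (fun ω : (Fin n → Fin (m ^ level T)) × (Fin n → Bool) =>
      δ ^ 2 / 32 ≤ energy (fun j => bucket (ω.1 j)) y (bucket (ω.1 i))) ≤ 256 * K * p := by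
    refine pr_prod_le_of_snd fun s => ?_
    refine (pr_le_energy_le bucket hbucket y hyi (by positivity)).trans ?_
    rw [div_le_iff₀ (by positivity)]
    nlinarith
  have h3 : pr (fun ω : (Fin n → Fin (m ^ level T)) × (Fin n → Bool) =>
      ∃ t ∈ range T, δ ^ 2 ≤ (∑ j, sgn (ω.2 j) *
        (if pre m (level T) (level t) (ω.1 j) = pre m (level T) (level t) (ω.1 i) then 1 * y j
          else 0)) ^ 2) ≤ T * (8 * K * p) := by
    refine (pr_exists_le_card_mul _ _ (c := 8 * K * p) fun t ht => ?_).trans (by simp)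
    have ht' : t ≤ T := (mem_range.mp ht).le
    refine (pr_le_sq_sum_sgn_le (fun a : Fin (m ^ level T) => pre m (level T) (level t) a)
      (fun a => (hpre t ht' a).trans (hpow _ (by linarith [six_le_level t])))
      (fun _ _ => 1) (D := 1) (by simp) y hyi (by positivity) zero_le_one).trans ?_
    rw [div_le_iff₀ (by positivity)]
    nlinarith
  have h4 : pr (fun ω : (Fin n → Fin (m ^ level T)) × (Fin n → Bool) =>
      ∃ t ∈ range T, (δ / 2) ^ 2 ≤ (∑ j, sgn (ω.2 j) *
        (if pre m (level T) (level t) (ω.1 j) = pre m (level T) (level t) (ω.1 i) then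
          ((pre m (level T) (level (t + 1)) (ω.1 j) : ℝ)
            - pre m (level T) (level (t + 1)) (ω.1 i)) * y j else 0)) ^ 2)
      ≤ T * (32 * K * p) := by
    refine (pr_exists_le_card_mul _ _ (c := 32 * K * p) fun t ht => ?_).trans (by simp)
    have ht' : t < T := mem_range.mp ht
    refine (pr_le_sq_sum_sgn_le (fun a : Fin (m ^ level T) => pre m (level T) (level t) a)
      (hpre t ht'.le)
      (fun a b => (pre m (level T) (level (t + 1)) b : ℝ) - pre m (level T) (level (t + 1)) a)
      (D := ((m : ℝ) ^ (level (t + 1) - level t)) ^ 2)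
      (fun a b h => sq_sub_pre_le (level_le_succ t) (level_mono ht') hm0 h)
      y hyi (by positivity) (by positivity)).trans ?_
    -- Weight growth against collision probability: here the recursion for the levels is used.
    have hD : ((m : ℝ) ^ (level (t + 1) - level t)) ^ 2 * (1 / (m : ℝ) ^ level t) ≤ p := by
      rw [mul_one_div, hp, div_le_div_iff₀ (by positivity) (by positivity), one_mul, ← pow_mul,
        ← pow_add]
      refine pow_le_pow_right₀ hm ?_
      have := two_mul_level_succ_le t
      have := level_le_succ t
      omega
    rw [div_le_iff₀ (by positivity)]
    calc _ ≤ p * (8 * K * δ ^ 2) := mul_le_mul hD hy (by positivity) hp0.le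
      _ = _ := by ring
  have h5 : pr (fun ω : (Fin n → Fin (m ^ level T)) × (Fin n → Bool) =>
      ∃ j ∈ Finset.univ.erase i, ω.1 i = ω.1 j) ≤ p := by
    refine (pr_exists_le_card_mul _ _ (c := 1 / (m : ℝ) ^ level T) fun j hj => ?_).trans ?_
    · refine pr_prod_le_of_snd fun s => ?_
      simpa using pr_eq_le (β := Fin (m ^ level T)) (ne_of_mem_erase hj).symm
    · have h : (#(Finset.univ.erase i) : ℝ) ≤ n := by
        exact_mod_cast card_erase_le.trans (by simp)
      have hn' : (n : ℝ) * (m : ℝ) ^ 2 ≤ (m : ℝ) ^ level T := by exact_mod_cast hn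
      rw [mul_one_div, hp, div_le_div_iff₀ (by positivity) (by positivity), one_mul]
      exact (mul_le_mul_of_nonneg_right h (by positivity)).trans hn'
  calc pr (BadLabels (T := T) (m := m) H y δ i)
      ≤ 2 * K * p + (256 * K * p + (T * (8 * K * p) + (T * (32 * K * p) + p))) := by
        unfold BadLabels
        refine (pr_or_le _ _).trans (add_le_add h1 ?_)
        refine (pr_or_le _ _).trans (add_le_add h2 ?_)
        refine (pr_or_le _ _).trans (add_le_add h3 ?_)
        exact (pr_or_le _ _).trans (add_le_add h4 h5)
    _ ≤ K * (259 + 40 * T) * p := by nlinarith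
    _ = _ := by rw [hp, mul_one_div]

theorem pr_recover_fails_le (hδ : 0 < δ) (hyH : ∀ j ∈ H, y j = 0) (hyx : ∀ j ∉ H, y j = x j)
    (hx : ∀ i ∈ H, 2 * δ ≤ |x i|) (hH : #H ≤ 2 * K) (hK : 1 ≤ K)
    (hy : ∑ j, y j ^ 2 ≤ 8 * K * δ ^ 2) (hn : n * m ^ 2 ≤ m ^ level T) :
    pr (fun ω : Seed n m T R (320 * K) => ¬ ∀ i ∈ H, (recover (258 * K) ω).run x i = x i)
      ≤ 2 * K ^ 2 * (259 + 40 * T) / (m : ℝ) ^ 2 + (m : ℝ) ^ 6 * (1 / 2) ^ R := by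
  classical
  have hK' : (1 : ℝ) ≤ K := by exact_mod_cast hK
  have hH' : (#H : ℝ) ≤ 2 * K := by exact_mod_cast hH
  have : NeZero (320 * K) := ⟨by omega⟩
  have h1 : pr (fun ω : Seed n m T R (320 * K) => ∃ i ∈ H, BadLabels H y δ i ω.1)
      ≤ 2 * K ^ 2 * (259 + 40 * T) / (m : ℝ) ^ 2 := by
    refine (pr_exists_le_card_mul _ _ fun i hi => pr_prod_le_of_snd fun s =>
      pr_badLabels_le hδ hyH hH hK hy hn hi).trans ?_
    calc _ ≤ 2 * (K : ℝ) * (K * (259 + 40 * T) / (m : ℝ) ^ 2) := by gcongr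
      _ = _ := by ring
  have h2 : pr (fun ω : Seed n m T R (320 * K) => ∃ b ∈ (Finset.univ : Finset (Fin (m ^ 6))),
      energy (fun j => bucket (ω.1.1 j)) y b ≤ δ ^ 2 / 32 ∧
        R ≤ 2 * #{r | BadRep (fun j => bucket (ω.1.1 j)) H y δ b (ω.2 r)})
      ≤ (m : ℝ) ^ 6 * (1 / 2) ^ R := by
    -- The labels are fixed first; the hash functions and signs of the sketch are independent of
    -- them.
    refine (pr_exists_le_card_mul _ _ (c := (1 / 2) ^ R) fun b _ =>
      pr_prod_le_of_fst fun a => ?_).trans (by simp)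
    by_cases hb : energy (fun j => bucket (a.1 j)) y b ≤ δ ^ 2 / 32
    · simp only [hb, true_and]
      refine pr_majority_le (p := BadRep (fun j => bucket (a.1 j)) H y δ b)
        ((pr_badRep_le _ H y hδ b).trans ?_)
      -- The constant 320 is tuned so that 1/160 + 1/32 + 1/40 = 1/16, as the majority bound
      -- requires.
      have e1 : (#H : ℝ) / (320 * K : ℕ) ≤ 1 / 160 := by
        rw [div_le_div_iff₀ (by positivity) (by positivity)]; push_cast; linarith
      have e2 : (∑ j, y j ^ 2) / (320 * K : ℕ) ≤ δ ^ 2 / 40 := by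
        rw [div_le_div_iff₀ (by positivity) (by positivity)]; push_cast; linarith
      have e3 : (energy (fun j => bucket (a.1 j)) y b + (∑ j, y j ^ 2) / (320 * K : ℕ)) / δ ^ 2
          ≤ 1 / 32 + 1 / 40 := by
        rw [div_le_iff₀ (by positivity)]; linarith
      linarith
    · simp only [hb, false_and]
      simp [pr]
  refine (pr_mono fun ω hω => ?_).trans ((pr_or_le _ _).trans (add_le_add h1 h2))
  by_contra hcon
  push Not at hcon
  exact hω fun i hi => run_recover_eq hδ hyH hyx hx hH hy hcon.1
    (fun b hb => not_le.mpr (hcon.2 b (mem_univ b) hb)) hi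

end Analysis

end Recover

/-! ### Reduction to finding heavy coordinates -/

section Reduction

variable {n : ℕ}

theorem norm_tailVec_sq (k : ℕ) (x : EuclideanSpace ℝ (Fin n)) :
    ‖tailVec k x‖ ^ 2 = ∑ i, if i ∈ headSet k x then 0 else x i ^ 2 := by
  rw [EuclideanSpace.real_norm_sq_eq]
  refine sum_congr rfl fun i _ => ?_
  simp only [tailVec]
  split_ifs <;> simp

theorem norm_tailVec_sq_anti (x : EuclideanSpace ℝ (Fin n)) {k K : ℕ} (h : k ≤ K) :
    ‖tailVec K x‖ ^ 2 ≤ ‖tailVec k x‖ ^ 2 := by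
  rw [norm_tailVec_sq, norm_tailVec_sq]
  refine sum_le_sum fun i _ => ?_
  by_cases hi : i ∈ headSet k x
  · have : i ∈ headSet K x := by
      simp only [headSet, mem_filter, mem_univ, true_and] at hi ⊢
      omega
    simp [hi, this]
  · simp only [hi, if_false]
    split_ifs <;> linarith [sq_nonneg (x i)]

theorem sum_headSet_const (k : ℕ) (x : EuclideanSpace ℝ (Fin n)) {r : ℝ} (hr : 0 ≤ r) :
    ∑ i, (if i ∈ headSet k x then r else 0) ≤ k * r := by
  rw [sum_ite_mem, univ_inter, sum_const, nsmul_eq_mul, card_headSet]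
  gcongr
  exact min_le_left _ _

/-- The coordinates that stand out against the tail, with a threshold separating them. -/
theorem exists_heavy (x : EuclideanSpace ℝ (Fin n)) {K : ℕ} (hK : 1 ≤ K) :
    ∃ (H : Finset (Fin n)) (y : Fin n → ℝ) (δ : ℝ), 0 < δ ∧ (∀ j ∈ H, y j = 0) ∧
      (∀ j ∉ H, y j = x j) ∧ (∀ i ∈ H, 2 * δ ≤ |x i|) ∧ #H ≤ 2 * K ∧
      ∑ j, y j ^ 2 ≤ 8 * K * δ ^ 2 ∧ ∀ i ∉ H, x i ^ 2 ≤ ‖tailVec K x‖ ^ 2 / K := by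
  classical
  have hK0 : (0 : ℝ) < K := by exact_mod_cast hK
  set q : ℝ := ‖tailVec K x‖ ^ 2 / K with hq
  have hq0 : 0 ≤ q := by positivity
  have hqK : ∑ i, (if i ∈ headSet K x then 0 else x i ^ 2) = K * q := by
    rw [← norm_tailVec_sq, hq]; field_simp
  -- The threshold is raised to the smallest square above q. It is thus positive even when the tail
  -- vanishes, and δ = √r / 2 turns the energy bound Kr + Kq into 8Kδ².
  obtain ⟨r, hr0, hqr, hr⟩ : ∃ r : ℝ, 0 < r ∧ q ≤ r ∧ ∀ i, q < x i ^ 2 → r ≤ x i ^ 2 := by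
    by_cases hne : (Finset.univ.filter fun i => q < x i ^ 2).Nonempty
    · obtain ⟨i, hi, hmin⟩ := exists_min_image _ (fun i => x i ^ 2) hne
      simp only [mem_filter, mem_univ, true_and] at hi hmin
      exact ⟨x i ^ 2, hq0.trans_lt hi, hi.le, hmin⟩
    · refine ⟨q + 1, by linarith, by linarith, fun i hi => (hne ⟨i, by simpa using hi⟩).elim⟩
  have hsq : (√r / 2) ^ 2 = r / 4 := by rw [div_pow, Real.sq_sqrt hr0.le]; norm_num
  refine ⟨({i | r ≤ x i ^ 2} : Finset (Fin n)), fun i => if r ≤ x i ^ 2 then 0 else x i, √r / 2, by positivity,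
    fun j hj => ?_, fun j hj => ?_, fun i hi => ?_, ?_, ?_, fun i hi => ?_⟩
  · simp only [mem_filter, mem_univ, true_and] at hj
    simp [hj]
  · simp only [mem_filter, mem_univ, true_and] at hj
    simp [hj]
  · simp only [mem_filter, mem_univ, true_and] at hi
    rw [mul_div_cancel₀ _ (two_ne_zero)]
    exact Real.sqrt_le_iff.mpr ⟨abs_nonneg _, by rwa [sq_abs]⟩
  · have h1 : ∑ i, (if r ≤ x i ^ 2 then r else 0)
        ≤ ∑ i, ((if i ∈ headSet K x then r else 0) + if i ∈ headSet K x then 0 else x i ^ 2) := by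
      refine sum_le_sum fun i _ => ?_
      split_ifs <;> first | linarith | positivity
    rw [sum_add_distrib, hqK, ← sum_filter, sum_const, nsmul_eq_mul] at h1
    have h2 := sum_headSet_const K x hr0.le
    have h3 : (K : ℝ) * q ≤ K * r := by gcongr
    have h4 : (#{i | r ≤ x i ^ 2} : ℝ) ≤ 2 * K := le_of_mul_le_mul_right (by linarith) hr0
    exact_mod_cast h4
  · rw [hsq]
    have h1 : ∑ i, (if r ≤ x i ^ 2 then 0 else x i) ^ 2
        ≤ ∑ i, ((if i ∈ headSet K x then r else 0) + if i ∈ headSet K x then 0 else x i ^ 2) := by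
      refine sum_le_sum fun i _ => ?_
      have := sq_nonneg (x i)
      split_ifs <;> linarith
    rw [sum_add_distrib, hqK] at h1
    have h2 := sum_headSet_const K x hr0.le
    have h3 : (K : ℝ) * q ≤ K * r := by gcongr
    linarith
  · simp only [mem_filter, mem_univ, true_and] at hi
    by_contra h
    exact hi (hr i (not_le.mp h))

/-- Recovering the heavy coordinates exactly and no others wrongly gives both guarantees. -/
theorem guarantees_of_heavy {x v : EuclideanSpace ℝ (Fin n)} {H : Finset (Fin n)} {k : ℕ} {ε : ℝ}
    (hk : 1 ≤ k) (hε : 0 < ε) (hε1 : ε ≤ 1) (hv : ∀ i, v i = x i ∨ v i = 0)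
    (hvH : ∀ i ∈ H, v i = x i)
    (hH : ∀ i ∉ H, x i ^ 2 ≤ ‖tailVec ⌈(k : ℝ) / ε⌉₊ x‖ ^ 2 / ⌈(k : ℝ) / ε⌉₊) :
    ‖x - v‖ ^ 2 ≤ (1 + ε) * ‖tailVec k x‖ ^ 2 ∧
      ∀ i : Fin n, |x i - v i| ^ 2 ≤ ε / (k : ℝ) * ‖tailVec ⌈(k : ℝ) / ε⌉₊ x‖ ^ 2 := by
  have hk0 : (0 : ℝ) < k := by exact_mod_cast hk
  set K := ⌈(k : ℝ) / ε⌉₊ with hK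
  have hKk : (k : ℝ) / ε ≤ K := Nat.le_ceil _
  have hkK : k ≤ K := by
    have : (k : ℝ) ≤ K := le_trans (by rw [le_div_iff₀ hε]; nlinarith) hKk
    exact_mod_cast this
  have hinf : ∀ i : Fin n, (x i - v i) ^ 2 ≤ ε / (k : ℝ) * ‖tailVec K x‖ ^ 2 := by
    intro i
    have h0 : 0 ≤ ε / (k : ℝ) * ‖tailVec K x‖ ^ 2 := by positivity
    by_cases hi : i ∈ H
    · simpa [hvH i hi] using h0
    rcases hv i with h | h
    · simpa [h] using h0
    · rw [h, sub_zero]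
      refine (hH i hi).trans ?_
      rw [div_eq_inv_mul]
      gcongr
      rw [← inv_div]
      exact inv_anti₀ (by positivity) hKk
  refine ⟨?_, fun i => by rw [sq_abs]; exact hinf i⟩
  have hanti := norm_tailVec_sq_anti x hkK
  -- The uniform bound is spent on the k head coordinates only, costing ε times the tail in total;
  -- elsewhere the error never exceeds x_i².
  have h1 : ‖x - v‖ ^ 2 ≤ ∑ i, ((if i ∈ headSet k x then ε / (k : ℝ) * ‖tailVec K x‖ ^ 2 else 0)
      + if i ∈ headSet k x then 0 else x i ^ 2) := by
    rw [EuclideanSpace.real_norm_sq_eq]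
    refine sum_le_sum fun i _ => ?_
    rw [PiLp.sub_apply]
    split_ifs
    · rw [add_zero]; exact hinf i
    · rw [zero_add]
      rcases hv i with h | h <;> rw [h]
      · rw [sub_self, zero_pow two_ne_zero]; positivity
      · rw [sub_zero]
  rw [sum_add_distrib, ← norm_tailVec_sq] at h1
  have h2 := sum_headSet_const k x (r := ε / (k : ℝ) * ‖tailVec K x‖ ^ 2) (by positivity)
  have h3 : (k : ℝ) * (ε / (k : ℝ) * ‖tailVec K x‖ ^ 2) = ε * ‖tailVec K x‖ ^ 2 := by
    field_simp
  have h4 : ε * ‖tailVec K x‖ ^ 2 ≤ ε * ‖tailVec k x‖ ^ 2 := by gcongr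
  linarith

theorem prob_map_uniform_le {Ω : Type} [Fintype Ω] [Nonempty Ω] (f : Ω → AdaptiveAlgorithm n)
    {P : AdaptiveAlgorithm n → Prop} {c : ℝ} (h : pr (fun ω => P (f ω)) ≤ c) :
    RandomizedAdaptiveAlgorithm.prob ((PMF.uniformOfFintype Ω).map f) P ≤ ENNReal.ofReal c := by
  classical
  refine le_trans (le_of_eq ?_) (ENNReal.ofReal_le_ofReal h)
  rw [RandomizedAdaptiveAlgorithm.prob, PMF.toOuterMeasure_map_apply,
    PMF.toOuterMeasure_uniformOfFintype_apply, pr_eq_card_div,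
    ENNReal.ofReal_div_of_pos (by exact_mod_cast Fintype.card_pos), ENNReal.ofReal_natCast,
    ENNReal.ofReal_natCast]
  congr 2
  rw [Fintype.card_subtype]
  rfl

end Reduction

/-! ### Choice of the parameters -/

section Parameters

theorem exp_le_five_fourths_pow {l : ℝ} {T : ℕ} (h : 5 * l ≤ T) : Real.exp l ≤ (5 / 4) ^ T := by
  have h1 : Real.exp (1 / 5) ≤ 5 / 4 := by
    have h := Real.add_one_le_exp (-(1 / 5) : ℝ)
    rw [Real.exp_neg] at h
    calc Real.exp (1 / 5) ≤ (4 / 5 : ℝ)⁻¹ := by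
          rw [le_inv_comm₀ (Real.exp_pos _) (by norm_num)]; linarith
      _ = _ := by norm_num
  calc Real.exp l ≤ Real.exp (T * (1 / 5)) := Real.exp_le_exp.mpr (by linarith)
    _ = Real.exp (1 / 5) ^ T := by rw [Real.exp_nat_mul]
    _ ≤ _ := by gcongr

theorem half_pow_le_exp {l : ℝ} {R : ℕ} (h : 2 * l ≤ R) : (1 / 2 : ℝ) ^ R ≤ Real.exp (-l) := by
  have h1 : (1 / 2 : ℝ) ≤ Real.exp (-(1 / 2)) := by
    have := Real.add_one_le_exp (-(1 / 2) : ℝ)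
    linarith
  calc (1 / 2 : ℝ) ^ R ≤ Real.exp (-(1 / 2)) ^ R := by gcongr
    _ = Real.exp (R * -(1 / 2)) := by rw [Real.exp_nat_mul]
    _ ≤ _ := Real.exp_le_exp.mpr (by linarith)

theorem six_mul_log_le {y : ℝ} (hy : 144 ≤ y) : 6 * Real.log y ≤ y := by
  have h12 : 12 ≤ √y := Real.le_sqrt_of_sq_le (by norm_num; exact hy)
  have h1 : Real.log (√y) ≤ √y - 1 := Real.log_le_sub_one_of_pos (by linarith)
  rw [Real.log_sqrt (by linarith)] at h1
  have h2 : √y * √y = y := Real.mul_self_sqrt (by linarith)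
  nlinarith

theorem one_le_log_of_le {y : ℝ} (hy : 3 ≤ y) : 1 ≤ Real.log y := by
  rw [Real.le_log_iff_exp_le (by linarith)]
  exact (Real.exp_one_lt_d9.trans (by norm_num)).le.trans hy

theorem exists_parameters {a b d y : ℝ} (ha : 0 < a) (hd : 0 < d)
    (hy : 144 + 4800 * b ^ 2 ≤ y) {n : ℕ} (hn : Real.log n = y) (hn0 : 0 < n) :
    ∃ m T R : ℕ, 0 < m ∧ n * m ^ 2 ≤ m ^ level T ∧ (T : ℝ) ≤ 6 * Real.log y ∧
      (R : ℝ) ≤ (12 * (a + d / 2 + 1) + 2 * d + 3) * Real.log y ∧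
      ∀ K : ℕ, (K : ℝ) ≤ 2 * b * y ^ a →
        2 * (K : ℝ) ^ 2 * (259 + 40 * T) / (m : ℝ) ^ 2 + (m : ℝ) ^ 6 * (1 / 2) ^ R
          ≤ 1 / y ^ d := by
  have hb2 := sq_nonneg b
  have hy144 : 144 ≤ y := by linarith
  have hy0 : 0 < y := by linarith
  have hy1 : 1 ≤ y := by linarith
  have hl1 := one_le_log_of_le (by linarith : 3 ≤ y)
  have hl6 := six_mul_log_le hy144
  set l := Real.log y with hl
  -- Then m² is at least y^(2a) · y^d · y²: these factors pay for K², for the target probability,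
  -- and for T together with the constants.
  set e : ℝ := a + d / 2 + 1 with he
  have he0 : 1 ≤ e := by linarith
  have hye : y ≤ y ^ e := Real.self_le_rpow_of_one_le hy1 he0
  set m := ⌈y ^ e⌉₊ with hm
  have hm1 : y ^ e ≤ m := Nat.le_ceil _
  have hm2 : (m : ℝ) ≤ 2 * y ^ e := by
    have := (Nat.ceil_lt_add_one (by positivity : 0 ≤ y ^ e)).le
    rw [← hm] at this
    linarith
  set T := ⌈5 * l⌉₊ with hT
  have hT1 : 5 * l ≤ T := Nat.le_ceil _
  have hT2 : (T : ℝ) ≤ 6 * l := by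
    have := (Nat.ceil_lt_add_one (by linarith : 0 ≤ 5 * l)).le
    rw [← hT] at this
    linarith
  -- Makes 2^(-R) at most y^(-(6e+d+1)), which beats the m^6 buckets with one factor y to spare
  -- against 2^6.
  set R := ⌈2 * ((6 * e + d + 1) * l)⌉₊ with hR
  have hR1 : 2 * ((6 * e + d + 1) * l) ≤ R := Nat.le_ceil _
  have hR2 : (R : ℝ) ≤ (12 * e + 2 * d + 3) * l := by
    have := (Nat.ceil_lt_add_one (by positivity : 0 ≤ 2 * ((6 * e + d + 1) * l))).le
    rw [← hR] at this
    linarith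
  have hm0 : 0 < m := Nat.ceil_pos.mpr (by positivity)
  have hm0' : (0 : ℝ) < m := by exact_mod_cast hm0
  refine ⟨m, T, R, hm0, ?_, hT2, hR2, fun K hK => ?_⟩
  · have hT3 : y ≤ (5 / 4 : ℝ) ^ T := by
      have := exp_le_five_fourths_pow hT1
      rwa [hl, Real.exp_log hy0] at this
    have h1 := six_mul_pow_le_level T
    have h2 : (⌈y⌉₊ : ℝ) < y + 1 := Nat.ceil_lt_add_one hy0.le
    have h3 : ⌈y⌉₊ + 2 ≤ level T := by
      have : ((⌈y⌉₊ + 2 : ℕ) : ℝ) ≤ level T := by push_cast; linarith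
      exact_mod_cast this
    have h4 : (n : ℝ) ≤ (m : ℝ) ^ ⌈y⌉₊ := by
      calc (n : ℝ) = Real.exp y := by rw [← hn, Real.exp_log (by exact_mod_cast hn0)]
        _ ≤ Real.exp (⌈y⌉₊ * 1) := Real.exp_le_exp.mpr (by rw [mul_one]; exact Nat.le_ceil _)
        _ = Real.exp 1 ^ ⌈y⌉₊ := by rw [Real.exp_nat_mul]
        _ ≤ _ := by
          gcongr
          have := Real.exp_one_lt_d9
          linarith
    have h4' : n ≤ m ^ ⌈y⌉₊ := by exact_mod_cast h4
    calc n * m ^ 2 ≤ m ^ ⌈y⌉₊ * m ^ 2 := by gcongr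
      _ = m ^ (⌈y⌉₊ + 2) := by rw [pow_add]
      _ ≤ _ := pow_le_pow_right₀ hm0 h3
  · have hyd : 0 < y ^ d := by positivity
    have h1 : 2 * (K : ℝ) ^ 2 * (259 + 40 * T) / (m : ℝ) ^ 2 ≤ 1 / 2 * (1 / y ^ d) := by
      have hsplit : (y ^ e) ^ 2 = (y ^ a) ^ 2 * y ^ d * y ^ 2 := by
        rw [← Real.rpow_natCast, ← Real.rpow_natCast, ← Real.rpow_natCast y, ← Real.rpow_mul hy0.le,
          ← Real.rpow_mul hy0.le, ← Real.rpow_add hy0, ← Real.rpow_add hy0]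
        congr 1
        push_cast
        rw [he]; ring
      calc 2 * (K : ℝ) ^ 2 * (259 + 40 * T) / (m : ℝ) ^ 2
          ≤ 2 * (2 * b * y ^ a) ^ 2 * (300 * y) / (y ^ e) ^ 2 := by
            gcongr
            linarith
        _ ≤ 1 / 2 * (1 / y ^ d) := by
            rw [hsplit, mul_one_div, div_le_div_iff₀ (by positivity) (by positivity)]
            have h : 2400 * b ^ 2 * y ≤ 1 / 2 * y ^ 2 := by nlinarith
            calc _ = (y ^ a) ^ 2 * y ^ d * (2400 * b ^ 2 * y) := by ring
              _ ≤ (y ^ a) ^ 2 * y ^ d * (1 / 2 * y ^ 2) := by gcongr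
              _ = _ := by ring
    have h2 : (m : ℝ) ^ 6 * (1 / 2) ^ R ≤ 1 / 2 * (1 / y ^ d) := by
      have hRe : (1 / 2 : ℝ) ^ R ≤ 1 / ((y ^ e) ^ 6 * y ^ d * y) := by
        refine (half_pow_le_exp hR1).trans (le_of_eq ?_)
        rw [one_div, Real.exp_neg, mul_comm _ l, hl, ← Real.rpow_def_of_pos hy0]
        congr 1
        rw [Real.rpow_add hy0, Real.rpow_add hy0, Real.rpow_one, mul_comm 6 e, Real.rpow_mul hy0.le]
        norm_cast
      calc (m : ℝ) ^ 6 * (1 / 2) ^ R ≤ (2 * y ^ e) ^ 6 * (1 / ((y ^ e) ^ 6 * y ^ d * y)) := by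
            gcongr
        _ = 64 / y * (1 / y ^ d) := by field_simp; norm_num
        _ ≤ _ := by
            refine mul_le_mul_of_nonneg_right ?_ (by positivity)
            rw [div_le_div_iff₀ hy0 two_pos]; linarith
    linarith

end Parameters

end SparseRecovery

/-! ### Assembly -/

open SparseRecovery in
theorem mainTheorem7 (a b d : ℝ) (ha : 0 < a) (hb : 0 < b) (hd : 0 < d) :
    ∃ C : ℝ, 0 < C ∧
      ∀ (n k : ℕ) (ε : ℝ), 3 ≤ n → 1 ≤ k → 0 < ε → ε ≤ 1 →
        (k : ℝ) / ε ≤ b * Real.log (n : ℝ) ^ a →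
        ∃ 𝒜 : RandomizedAdaptiveAlgorithm n,
          (∀ A ∈ PMF.support 𝒜, ∀ x : EuclideanSpace ℝ (Fin n),
            (A.numMeasurements x : ℝ) ≤ C * ((k : ℝ) / ε) * Real.log (Real.log (n : ℝ)) ∧
            (A.numRounds x : ℝ) ≤ C * Real.log (Real.log (n : ℝ))) ∧
          ∀ x : EuclideanSpace ℝ (Fin n),
            𝒜.prob (fun A =>
              ¬ (‖x - A.run x‖ ^ 2 ≤ (1 + ε) * ‖tailVec k x‖ ^ 2 ∧
                ∀ i : Fin n,
                  |x i - A.run x i| ^ 2 ≤ ε / (k : ℝ) * ‖tailVec ⌈(k : ℝ) / ε⌉₊ x‖ ^ 2))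
              ≤ ENNReal.ofReal (1 / Real.log (n : ℝ) ^ d) := by
  have hlog3 : 1 < Real.log 3 := by
    rw [Real.lt_log_iff_exp_lt (by norm_num)]
    exact Real.exp_one_lt_d9.trans (by norm_num)
  set l₃ := Real.log (Real.log 3) with hl₃
  have hl₃0 : 0 < l₃ := Real.log_pos hlog3
  set y₀ : ℝ := 144 + 4800 * b ^ 2 with hy₀
  set c : ℝ := 12 * (a + d / 2 + 1) + 2 * d + 3 with hc
  -- The first summand covers bounded n, where all coordinates are read in one round; dividing by l₃
  -- = log log 3 compensates a small log log n. The second covers large n, doubled because K ≤ 2k/ε.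
  refine ⟨Real.exp y₀ / l₃ + (640 * c + 8000), by positivity, fun n k ε hn hk hε hε1 hkε => ?_⟩
  have hn3 : (3 : ℝ) ≤ n := by exact_mod_cast hn
  have hk1 : (1 : ℝ) ≤ k := by exact_mod_cast hk
  have hkε1 : 1 ≤ (k : ℝ) / ε := by rw [le_div_iff₀ hε]; linarith
  have hl3n : l₃ ≤ Real.log (Real.log n) :=
    Real.log_le_log (by linarith) (Real.log_le_log (by norm_num) hn3)
  set y := Real.log n with hy
  set l := Real.log y with hl
  have hl0 : 0 < l := hl₃0.trans_le hl3n
  have : NeZero n := ⟨by omega⟩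
  rcases lt_or_ge y y₀ with hsmall | hlarge
  · have hnexp : (n : ℝ) ≤ Real.exp y₀ := by
      rw [← Real.exp_log (by linarith : (0 : ℝ) < n)]
      exact Real.exp_le_exp.mpr hsmall.le
    have hC : Real.exp y₀ ≤ (Real.exp y₀ / l₃ + (640 * c + 8000)) * l := by
      calc Real.exp y₀ = Real.exp y₀ / l₃ * l₃ := by field_simp
        _ ≤ _ := by
          gcongr
          have : 0 < 640 * c + 8000 := by positivity
          linarith
    refine ⟨PMF.pure (readCoords id), fun A hA x => ?_, fun x => ?_⟩
    · rw [PMF.mem_support_pure_iff] at hA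
      subst hA
      rw [numMeasurements_readCoords, numRounds_readCoords]
      refine ⟨hnexp.trans (hC.trans ?_), ?_⟩
      · rw [mul_right_comm]
        refine le_mul_of_one_le_right ?_ hkε1
        positivity
      · push_cast
        linarith
    · have hrun : (readCoords id).run x = x := by
        ext i
        rw [run_readCoords]
        simp
      rw [RandomizedAdaptiveAlgorithm.prob, PMF.toOuterMeasure_pure_apply, if_neg]
      · exact zero_le
      · rw [Set.mem_ofPred_eq, not_not, hrun]
        simp only [sub_self, norm_zero, abs_zero, zero_pow two_ne_zero]
        exact ⟨by positivity, fun i => by positivity⟩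
  · obtain ⟨m, T, R, hm, hnm, hT, hR, hfail⟩ :=
      exists_parameters (b := b) ha hd hlarge hy.symm (by omega)
    have : NeZero m := ⟨hm.ne'⟩
    replace hR : (R : ℝ) ≤ c * l := hR
    have hy144 : 144 ≤ y := by nlinarith
    have hl1 : 1 ≤ l := one_le_log_of_le (by linarith)
    set K := ⌈(k : ℝ) / ε⌉₊ with hK
    have hK1 : 1 ≤ K := Nat.one_le_ceil_iff.mpr (by linarith)
    have hK2 : (K : ℝ) ≤ 2 * ((k : ℝ) / ε) := by
      have := (Nat.ceil_lt_add_one (by linarith : 0 ≤ (k : ℝ) / ε)).le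
      rw [← hK] at this
      linarith
    have : NeZero (320 * K) := ⟨by omega⟩
    have : Nonempty (Seed n m T R (320 * K)) := ⟨(fun _ => 0, fun _ => true), fun _ =>
      (fun _ => 0, fun _ => true)⟩
    have hCl : ∀ s : ℝ, s ≤ 640 * c + 8000 →
        s * l ≤ (Real.exp y₀ / l₃ + (640 * c + 8000)) * l := fun s hs => by
      gcongr
      have : 0 < Real.exp y₀ / l₃ := by positivity
      linarith
    refine ⟨(PMF.uniformOfFintype (Seed n m T R (320 * K))).map (recover (258 * K)),
      fun A hA x => ?_, fun x => ?_⟩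
    · rw [PMF.mem_support_map_iff] at hA
      obtain ⟨ω, -, rfl⟩ := hA
      constructor
      · have h1 : ((recover (258 * K) ω).numMeasurements x : ℝ)
            ≤ R * (320 * K) + T * (258 * K * 2) + 258 * K := by
          exact_mod_cast numMeasurements_recover_le (258 * K) ω x
        have h2 : (320 : ℝ) * R + 516 * T + 258 ≤ (320 * c + 4000) * l := by linarith
        calc ((recover (258 * K) ω).numMeasurements x : ℝ)
            ≤ (320 * R + 516 * T + 258) * K := h1.trans (le_of_eq (by ring))
          _ ≤ ((320 * c + 4000) * l) * (2 * ((k : ℝ) / ε)) := by gcongr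
          _ = ((640 * c + 8000) * l) * ((k : ℝ) / ε) := by ring
          _ ≤ ((Real.exp y₀ / l₃ + (640 * c + 8000)) * l) * ((k : ℝ) / ε) := by
            gcongr ?_ * _
            exact hCl _ le_rfl
          _ = _ := by ring
      · have h1 : ((recover (258 * K) ω).numRounds x : ℝ) ≤ T + 2 := by
          exact_mod_cast numRounds_recover_le (258 * K) ω x
        have h2 : (T : ℝ) + 2 ≤ 8 * l := by linarith
        have hc0 : 0 < c := by positivity
        exact h1.trans (h2.trans (hCl _ (by linarith)))
    · obtain ⟨H, v, δ, hδ, hyH, hyx, hx, hH, hv, hrest⟩ := exists_heavy x hK1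
      refine prob_map_uniform_le _ ((pr_mono fun ω hω => ?_).trans
        ((pr_recover_fails_le hδ hyH hyx hx hH hK1 hv hnm).trans
          (hfail K (hK2.trans (by linarith)))))
      exact fun hgood => hω
        (guarantees_of_heavy hk hε hε1 (run_recover_eq_or _ ω x) hgood hrest)
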